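/- Let $\gamma\neq 0$, $\mu>0$, $\nu\in(0,1]$. For $x,t>0$ put $$\tilde g^{\gamma}_{\mu}(x,t)=g^\gamma_\mu(x,t^{1/\gamma}),\qquad g^\gamma_\mu(x,t)=\operatorname{sign}(\gamma)\,\frac1t\,Q^\gamma_\mu\!\left(\frac xt\right),\qquad Q^\gamma_\mu(z)=\gamma\,\frac{z^{\gamma\mu-1}}{\Gamma(\mu)}\,e^{-z^{\gamma}},$$ and, for $\nu\in(0,1)$ and $s,t>0$, let $$l_\nu(s,t)=\frac1{t^\nu}\,H^{1,0}_{1,1}\!\left[\frac{s}{t^\nu}\,\Big|\,{(1-\nu,\nu)\atop(0,1)}\right]=\frac1{t^\nu}\,\frac1{2\pi i}\int_{1-i\infty}^{1+i\infty}\frac{\Gamma(\eta)}{\Gamma(1-\nu+\nu\eta)}\left(\frac{s}{t^\nu}\right)^{-\eta}d\eta$$ (the density of the inverse of the $\nu$-stable subordinator). Define $$u(x,t)=\int_0^\infty \tilde g^\gamma_\mu(x,s)\,l_\nu(s,t)\,ds\quad(0<\nu<1),\qquad u(x,t)=\tilde g^\gamma_\mu(x,t)\quad(\nu=1).$$ Let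 $$\mathcal G^*f(x)=\frac1{\gamma^2}\frac{\partial}{\partial x}\left(x^{\gamma\mu-\gamma+1}\frac{\partial}{\partial x}\left(\frac{f(x)}{x^{\gamma\mu-1}}\right)\right),$$ and let $\partial^\nu_t$ be the Riemann--Liouville derivative $\partial_t^\nu f(t)=\frac1{\Gamma(1-\nu)}\frac{d}{dt}\int_0^t(t-s)^{-\nu}f(s)\,ds$ for $0<\nu<1$ and the ordinary derivative for $\nu=1$. Then, for $\nu<1$, the integrals defining $l_\nu$ and $u$ converge absolutely; $u(\cdot,t)$ is twice continuously differentiable on $(0,\infty)$ for every $t>0$; the derivative $\partial^\nu_t u$ exists, and $$\partial^\nu_t u(x,t)=\mathcal G^*u(x,t),\qquad x\in(0,\infty),\ t>0.$$ The initial data is a unit point mass, in the following sense. For every $t>0$ the function $u(\cdot,t)$ is integrable on $(0,\infty)$ with $\int_0^\infty u(x,t)\,dx=1$, and $\lim_{t\to0+}u(x,t)=0$ for every $x>0$. If $\gamma>0$, then $u(x,t)\,dx\to\delta_0$ weakly as $t\to0+$, that is, $\int_0^\infty\varphi(x)u(x,t)\,dx\to\varphi(0)$ for every bounded continuous $\varphi:\mathbb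 R\to\mathbb R$. If $\gamma<0$, then the mass concentrates at the endpoint $x=+\infty$: $\int_0^\infty\varphi(x)u(x,t)\,dx\to\lim_{x\to\infty}\varphi(x)$ as $t\to0+$ for every bounded continuous $\varphi:\mathbb R\to\mathbb R$ that has a finite limit at $+\infty$. -/

import Mathlib

open Real Set Filter Topology MeasureTheory

noncomputable section

/-- The function `Q^γ_μ(z) = γ z^(γμ-1) exp(-z^γ) / Γ(μ)`, for `z > 0`. -/
def genGammaQ (γ μ z : ℝ) : ℝ :=
  γ * (z ^ (γ * μ - 1) / Real.Gamma μ) * Real.exp (-z ^ γ)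

/-- The generalized gamma density `g^γ_μ(x,t) = sign(γ) t⁻¹ Q^γ_μ(x/t)`, for `x, t > 0`. -/
def genGamma (γ μ x t : ℝ) : ℝ :=
  Real.sign γ * (1 / t) * genGammaQ γ μ (x / t)

/-- The time-changed density `g̃^γ_μ(x,t) = g^γ_μ(x, t^(1/γ))`, for `x, t > 0`. -/
def genGammaTilde (γ μ x t : ℝ) : ℝ :=
  genGamma γ μ x (t ^ (1 / γ))

/-- The Mellin transform of the Fox function `H^{m,n}_{p,q}` with upper parameters
`(a_i, α_i)`, `i < p`, and lower parameters `(b_j, β_j)`, `j < q`. -/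
def foxKernel {p q : ℕ} (m n : ℕ) (a : Fin p → ℝ × ℝ) (b : Fin q → ℝ × ℝ) (η : ℂ) : ℂ :=
  ((∏ j : Fin q with j.val < m, Complex.Gamma ((b j).1 + η * (b j).2)) *
      ∏ i : Fin p with i.val < n, Complex.Gamma (1 - (a i).1 - η * (a i).2)) /
    ((∏ j : Fin q with m ≤ j.val, Complex.Gamma (1 - (b j).1 - η * (b j).2)) *
      ∏ i : Fin p with n ≤ i.val, Complex.Gamma ((a i).1 + η * (a i).2))

/-- The Fox function `H^{m,n}_{p,q}`: the Mellin-Barnes integral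
`(2πi)⁻¹ ∫ foxKernel(η) x^(-η) dη` along the vertical line `Re η = c`, which is to lie in the
fundamental strip. -/
def foxH {p q : ℕ} (c : ℝ) (m n : ℕ) (a : Fin p → ℝ × ℝ) (b : Fin q → ℝ × ℝ) (x : ℝ) : ℂ :=
  mellinInv c (foxKernel m n a b) x

/-- The Mellin transform `Γ(η) / Γ(1 - ν + ν η)` of `H^{1,0}_{1,1}` with upper parameter
`(1 - ν, ν)` and lower parameter `(0, 1)`; the fundamental strip is `Re η > 0`. -/
def invStableKernel (ν : ℝ) : ℂ → ℂ :=
  foxKernel 1 0 ![(1 - ν, ν)] ![(0, 1)]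

/-- The density `l_ν(s,t) = t^(-ν) H^{1,0}_{1,1}[s / t^ν]` of the inverse `ν`-stable subordinator
at time `t`, for `0 < ν < 1` and `s, t > 0`. The kernel takes conjugate values at conjugate points,
so the Mellin-Barnes integral is real and nothing is lost in taking the real part. -/
def invStableDensity (ν s t : ℝ) : ℝ :=
  1 / t ^ ν * (foxH 1 1 0 ![(1 - ν, ν)] ![((0 : ℝ), (1 : ℝ))] (s / t ^ ν)).re

/-- `ũ^{γ,μ}_ν(x,t) = ∫₀^∞ g̃^γ_μ(x,s) l_ν(s,t) ds`. For `ν = 1` the inverse subordinator is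
deterministic, `l_1(s,t) ds` is the unit mass at `s = t`, and the integral is `g̃^γ_μ(x,t)`. -/
def fracSol (γ μ ν x t : ℝ) : ℝ :=
  if ν = 1 then genGammaTilde γ μ x t
  else ∫ s in Ioi (0 : ℝ), genGammaTilde γ μ x s * invStableDensity ν s t

/-- The operator `𝒢* f = γ⁻² ∂ₓ (x^(γμ-γ+1) ∂ₓ (f / 𝔴))` with `𝔴(x) = x^(γμ-1)`, for functions
that are twice differentiable on `(0,∞)`. -/
def gStar (γ μ : ℝ) (f : ℝ → ℝ) (x : ℝ) : ℝ :=
  1 / γ ^ 2 *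
    deriv (fun y => y ^ (γ * μ - γ + 1) * deriv (fun z => 1 / z ^ (γ * μ - 1) * f z) y) x

/-- The function `f` on `(0,∞)` has at `t > 0` the Riemann-Liouville derivative `d` of order
`α ∈ (0,1]`: the fractional integral of order `1 - α` exists at every `r > 0` and is
differentiable at `t` with derivative `d`. For `α = 1` this is the ordinary derivative. -/
def HasRLDerivAt (α : ℝ) (f : ℝ → ℝ) (d t : ℝ) : Prop :=
  if α = 1 then HasDerivAt f d t
  else
    (∀ r > 0, IntervalIntegrable (fun s => (r - s) ^ (-α) * f s) volume 0 r) ∧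
      HasDerivAt (fun r => 1 / Real.Gamma (1 - α) * ∫ s in (0 : ℝ)..r, (r - s) ^ (-α) * f s) d t

end

/-! For `ν < 1` everything is read off from one Mellin–Barnes formula. Inserting the contour
integral for `l_ν` and integrating in `s` first leaves a Gamma integral, so `u(x,t) = |γ| / (Γ(μ) x)
· Re H(x^γ / t^ν)`, where `H` is the inverse Mellin transform along `Re z = 0` of `Γ(1+z) Γ(μ+z) /
Γ(1+νz)` (`fracSol_eq`).

On such integrals the operators act by multiplying the kernel. `𝒢*` produces the factor
`(1+z)(μ+z)`, which raises the arguments of both numerator Gammas by one (`gStar_fracSol`). The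
fractional integral replaces `Γ(1+νz)` by `Γ(2-ν+νz)` through a Beta integral (`fracInt_fracSol`),
and `d/dt` then gives `Γ(1-ν+νz)`. The two resulting kernels differ by the translation `z ↦ z - 1`,
and no pole separates the two contours; this is the equation (`mellinInv_fracIntKernel`). Moving the
contour to the right instead gives decay in `x^γ / t^ν`, hence `u → 0` pointwise.

All contour manipulations rest on exponential decay of the kernels in vertical strips: `Γ` decays at
any rate `θ < π/2`, `1/Γ` grows at rate at most `π - θ`, and the factor `ν < 1` in the denominator
leaves a positive net rate.

For the initial data, `g̃(·,t)` is the law of `(tV)^(1/γ)` with `V` Gamma distributed, and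
`l_ν(·,t)` is the rescaling by `t^ν` of a fixed integrable function whose integral is 1 by Mellin
inversion. Fubini and dominated convergence give the mass and the weak limit. The case `ν = 1` is a
direct computation. -/

/-! ### Exponential bounds for the Gamma function and its reciprocal. -/

theorem integrableOn_rpow_mul_exp_neg_mul {p b : ℝ} (hp : 0 < p) (hb : 0 < b) :
    IntegrableOn (fun t : ℝ => t ^ (p - 1) * rexp (-(b * t))) (Ioi 0) := by
  have := integrableOn_rpow_mul_exp_neg_mul_rpow (p := 1) (s := p - 1) (b := b) (by linarith)
    one_pos hb
  simpa using this

theorem norm_cpow_mul_cexp_neg_mul {t : ℝ} (ht : 0 < t) (a r : ℂ) :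
    ‖(t : ℂ) ^ a * Complex.exp (-(r * t))‖ = t ^ a.re * rexp (-(r.re * t)) := by
  rw [norm_mul, Complex.norm_cpow_eq_rpow_re_of_pos ht, Complex.norm_exp]
  simp

theorem aestronglyMeasurable_cpow_mul_cexp (a r : ℂ) :
    AEStronglyMeasurable (fun t : ℝ => (t : ℂ) ^ a * Complex.exp (-(r * t)))
      (volume.restrict (Ioi 0)) := by
  refine ContinuousOn.aestronglyMeasurable (fun t ht => ?_) measurableSet_Ioi
  refine ContinuousAt.continuousWithinAt (ContinuousAt.mul ?_ (by fun_prop))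
  exact Complex.continuousAt_ofReal_cpow_const _ _ (Or.inr (ne_of_gt ht))

theorem integrableOn_cpow_mul_cexp {a r : ℂ} (ha : 0 < a.re) (hr : 0 < r.re) :
    IntegrableOn (fun t : ℝ => (t : ℂ) ^ (a - 1) * Complex.exp (-(r * t))) (Ioi 0) := by
  refine Integrable.mono' (integrableOn_rpow_mul_exp_neg_mul ha hr)
    (aestronglyMeasurable_cpow_mul_cexp _ _) ?_
  filter_upwards [ae_restrict_mem measurableSet_Ioi] with t ht
  rw [norm_cpow_mul_cexp_neg_mul ht]
  simp

/-- The Laplace transform of `t ^ (a - 1)`, on the whole right half-plane. -/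
theorem integral_cpow_mul_cexp_neg_mul {a r : ℂ} (ha : 0 < a.re) (hr : 0 < r.re) :
    ∫ t : ℝ in Ioi 0, (t : ℂ) ^ (a - 1) * Complex.exp (-(r * t)) =
      (1 / r) ^ a * Complex.Gamma a := by
  set U : Set ℂ := {z | 0 < z.re} with hU
  have hUo : IsOpen U := isOpen_lt continuous_const Complex.continuous_re
  have hd : DifferentiableOn ℂ
      (fun r : ℂ => ∫ t : ℝ in Ioi 0, (t : ℂ) ^ (a - 1) * Complex.exp (-(r * t))) U := by
    intro z hz
    have hz' : 0 < z.re / 2 := half_pos hz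
    have hs : {w : ℂ | z.re / 2 < w.re} ∈ 𝓝 z :=
      (isOpen_lt continuous_const Complex.continuous_re).mem_nhds (by
        change z.re / 2 < z.re; linarith)
    refine DifferentiableAt.differentiableWithinAt ?_
    refine HasDerivAt.differentiableAt (hasDerivAt_integral_of_dominated_loc_of_deriv_le
      (F := fun (r : ℂ) (t : ℝ) => (t : ℂ) ^ (a - 1) * Complex.exp (-(r * t)))
      (F' := fun (r : ℂ) (t : ℝ) => (t : ℂ) ^ (a - 1) * (Complex.exp (-(r * t)) * -t))
      -- Differentiating in `r` brings down a factor `t`, so the bound is the Gamma integrand with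
      -- exponent `a.re + 1`.
      (bound := fun t : ℝ => t ^ ((a.re + 1) - 1) * rexp (-(z.re / 2 * t)))
      hs (Eventually.of_forall fun w => aestronglyMeasurable_cpow_mul_cexp _ _)
      (integrableOn_cpow_mul_cexp ha hz) ?_ ?_
      (integrableOn_rpow_mul_exp_neg_mul (by linarith) hz') ?_).2
    · have := (aestronglyMeasurable_cpow_mul_cexp (a - 1) z).mul
        (g := fun t : ℝ => (-t : ℂ)) (by fun_prop)
      refine this.congr (Eventually.of_forall fun t => ?_)
      simp only [Pi.mul_apply]
      ring
    · filter_upwards [ae_restrict_mem measurableSet_Ioi] with t ht w hw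
      have ht' : 0 < t := ht
      rw [← mul_assoc, norm_mul, norm_cpow_mul_cexp_neg_mul ht, norm_neg, Complex.norm_real,
        Real.norm_of_nonneg ht'.le]
      have h1 : t ^ (a.re + 1 - 1) = t ^ ((a - 1).re) * t := by
        rw [← Real.rpow_add_one ht'.ne']
        simp
      rw [h1, mul_right_comm]
      have hw' : z.re / 2 < w.re := hw
      gcongr
    · filter_upwards [ae_restrict_mem measurableSet_Ioi] with t ht w hw
      refine HasDerivAt.const_mul _ (HasDerivAt.cexp ?_)
      simpa using ((hasDerivAt_id' w).mul_const (t : ℂ)).fun_neg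
  have hg : DifferentiableOn ℂ (fun r : ℂ => (1 / r) ^ a * Complex.Gamma a) U := by
    intro z hz
    have hz0 : z ≠ 0 := by
      rintro rfl
      simp [hU] at hz
    refine DifferentiableAt.differentiableWithinAt (DifferentiableAt.mul_const ?_ _)
    refine DifferentiableAt.cpow_const (by fun_prop (disch := exact hz0)) (Or.inl ?_)
    rw [one_div, Complex.inv_re]
    exact div_pos hz (Complex.normSq_pos.2 hz0)
  have hconv : IsPreconnected U := (convex_halfSpace_re_gt 0).isPreconnected
  refine (hd.analyticOnNhd hUo).eqOn_of_preconnected_of_frequently_eq (hg.analyticOnNhd hUo)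
    hconv (z₀ := 1) (by simp [hU]) ?_ hr
  -- The formula is known for real `r > 0`; these points accumulate at 1, which is enough for the
  -- identity theorem.
  have ht : Tendsto (fun n : ℕ => ((1 + 1 / ((n : ℝ) + 1) : ℝ) : ℂ)) atTop (𝓝[≠] 1) := by
    refine tendsto_nhdsWithin_iff.2 ⟨?_, Eventually.of_forall fun n => ?_⟩
    · have := (tendsto_one_div_add_atTop_nhds_zero_nat (𝕜 := ℝ)).const_add 1
      rw [add_zero] at this
      exact (Complex.continuous_ofReal.tendsto 1).comp this
    · have : (0 : ℝ) < 1 / ((n : ℝ) + 1) := by positivity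
      simp only [mem_compl_iff, mem_singleton_iff]
      intro h
      have h2 : (1 + 1 / ((n : ℝ) + 1) : ℝ) = 1 := by exact_mod_cast h
      linarith
  refine ht.frequently (Frequently.of_forall fun n => ?_)
  exact Complex.integral_cpow_mul_exp_neg_mul_Ioi ha (by positivity)

/-- The Gamma function decays exponentially along vertical lines. -/
theorem norm_Gamma_le_exp {z : ℂ} (hz : 0 < z.re) {θ : ℝ} (hθ : |θ| < π / 2) :
    ‖Complex.Gamma z‖ ≤ (1 / cos θ) ^ z.re * Real.Gamma z.re * rexp (-(θ * z.im)) := by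
  have hθ' := abs_lt.1 hθ
  have hc : 0 < cos θ := cos_pos_of_mem_Ioo hθ'
  -- On the rotated ray `|r^(-z)| = exp(θ Im z)`, while the modulus of the integrand sees only `Re r
  -- = cos θ`.
  set r : ℂ := Complex.exp (θ * Complex.I) with hr
  have hre : r.re = cos θ := by rw [hr, Complex.exp_ofReal_mul_I_re]
  have h1 := integral_cpow_mul_cexp_neg_mul (r := r) hz (by rw [hre]; exact hc)
  have h2 : ‖∫ t : ℝ in Ioi 0, (t : ℂ) ^ (z - 1) * Complex.exp (-(r * t))‖ ≤
      (1 / cos θ) ^ z.re * Real.Gamma z.re := by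
    rw [← Real.integral_rpow_mul_exp_neg_mul_Ioi hz hc]
    refine (norm_integral_le_integral_norm _).trans (le_of_eq ?_)
    refine setIntegral_congr_fun measurableSet_Ioi fun t ht => ?_
    rw [norm_cpow_mul_cexp_neg_mul ht, hre]
    simp
  have h3 : ‖(1 / r) ^ z‖ = rexp (θ * z.im) := by
    have : 1 / r = Complex.exp ((-θ * Complex.I)) := by
      rw [hr, one_div, ← Complex.exp_neg]; ring_nf
    rw [this, Complex.cpow_def_of_ne_zero (Complex.exp_ne_zero _), Complex.log_exp,
      Complex.norm_exp]
    · simp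
    · simp; linarith
    · simp; linarith
  rw [h1, norm_mul, h3] at h2
  rw [Real.exp_neg, ← div_eq_mul_inv, le_div_iff₀ (exp_pos _)]
  linarith

theorem exists_norm_Gamma_le {a b θ : ℝ} (ha : 0 < a) (hθ0 : 0 ≤ θ) (hθ : θ < π / 2) :
    ∃ C, 0 < C ∧ ∀ z : ℂ, a ≤ z.re → z.re ≤ b →
      ‖Complex.Gamma z‖ ≤ C * rexp (-(θ * |z.im|)) := by
  have hc : 0 < cos θ := cos_pos_of_mem_Ioo ⟨by linarith, hθ⟩
  have hcont : ContinuousOn (fun x : ℝ => (1 / cos θ) ^ x * Real.Gamma x) (Icc a b) := by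
    intro x hx
    have hx0 : 0 < x := ha.trans_le hx.1
    refine ContinuousAt.continuousWithinAt (ContinuousAt.mul ?_ ?_)
    · exact (Real.continuous_const_rpow (by positivity)).continuousAt
    · refine (Real.differentiableAt_Gamma fun m h => ?_).continuousAt
      have : (0 : ℝ) ≤ m := m.cast_nonneg
      linarith
  obtain ⟨C, hC⟩ := isCompact_Icc.exists_bound_of_continuousOn hcont
  refine ⟨max C 1, by positivity, fun z h1 h2 => ?_⟩
  have hz : 0 < z.re := ha.trans_le h1
  have key : ‖Complex.Gamma z‖ ≤ (1 / cos θ) ^ z.re * Real.Gamma z.re *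
      rexp (-(θ * |z.im|)) := by
    rcases le_total 0 z.im with h | h
    · rw [abs_of_nonneg h]
      exact norm_Gamma_le_exp hz (by rwa [abs_of_nonneg hθ0])
    · rw [abs_of_nonpos h]
      have := norm_Gamma_le_exp hz (θ := -θ) (by rwa [abs_neg, abs_of_nonneg hθ0])
      rw [cos_neg] at this
      convert! this using 3
      ring
  refine key.trans (mul_le_mul_of_nonneg_right ?_ (exp_pos _).le)
  exact (le_abs_self _).trans ((hC z.re ⟨h1, h2⟩).trans (le_max_left _ _))

theorem norm_sin_pi_mul_le (z : ℂ) : ‖Complex.sin (π * z)‖ ≤ rexp (π * |z.im|) := by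
  rw [Complex.sin, norm_div, norm_mul, Complex.norm_I, mul_one, Complex.norm_ofNat,
    div_le_iff₀ two_pos]
  refine (norm_sub_le _ _).trans ?_
  rw [Complex.norm_exp, Complex.norm_exp]
  have h1 : (-(π * z) * Complex.I).re ≤ π * |z.im| := by
    simp
    exact mul_le_mul_of_nonneg_left (le_abs_self _) pi_pos.le
  have h2 : (π * z * Complex.I).re ≤ π * |z.im| := by
    simp
    rw [← mul_neg]
    exact mul_le_mul_of_nonneg_left (neg_le_abs _) pi_pos.le
  have := exp_le_exp.2 h1
  have := exp_le_exp.2 h2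
  linarith

/-- For `Re z ≤ 1/2` the reflection formula writes `1/Γ(z)` as `Γ(1-z) sin(πz) / π`, with decay rate
`θ` against growth rate `π`. Further right, `Γ(z) = (z-1) Γ(z-1)` with `|z-1| ≥ |Im z| ≥ 1` shows
that each unit step costs nothing, so `C` serves every `n`. -/
theorem exists_norm_inv_Gamma_le_of_one_le_im {a θ : ℝ} (hθ0 : 0 ≤ θ) (hθ : θ < π / 2) :
    ∃ C, 0 < C ∧ ∀ n : ℕ, ∀ z : ℂ, a ≤ z.re → z.re ≤ 1 / 2 + n → 1 ≤ |z.im| →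
      ‖(Complex.Gamma z)⁻¹‖ ≤ C * rexp ((π - θ) * |z.im|) := by
  obtain ⟨C, hC0, hC⟩ := exists_norm_Gamma_le (a := 1 / 2) (b := 1 - min a (-1 / 2))
    (by norm_num) hθ0 hθ
  refine ⟨C, hC0, fun n => ?_⟩
  -- The left edge is lowered to at most `-1/2` so that `z - 1` stays in range when `Re z > 1/2`.
  suffices h : ∀ z : ℂ, min a (-1 / 2) ≤ z.re → z.re ≤ 1 / 2 + n → 1 ≤ |z.im| →
      ‖(Complex.Gamma z)⁻¹‖ ≤ C * rexp ((π - θ) * |z.im|) from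
    fun z h1 => h z ((min_le_left _ _).trans h1)
  induction n with
  | zero =>
    intro z h1 h2 h3
    have hr := Complex.Gamma_mul_Gamma_one_sub z
    have hsin : Complex.sin (π * z) ≠ 0 := by
      intro h
      obtain ⟨k, hk⟩ := Complex.sin_eq_zero_iff.1 h
      have hpi : (π : ℂ) ≠ 0 := by exact_mod_cast pi_ne_zero
      have : z = k := by
        rw [mul_comm] at hk
        exact mul_right_cancel₀ hpi hk
      rw [this] at h3
      norm_num at h3
    have hG : Complex.Gamma z ≠ 0 := by
      intro h
      rw [h, zero_mul, eq_comm, div_eq_zero_iff] at hr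
      rcases hr with hr | hr
      · exact pi_ne_zero (by exact_mod_cast hr)
      · exact hsin hr
    have hpi : (π : ℂ) ≠ 0 := by exact_mod_cast pi_ne_zero
    have : (Complex.Gamma z)⁻¹ = Complex.Gamma (1 - z) * Complex.sin (π * z) / π := by
      rw [eq_div_iff hpi, inv_mul_eq_iff_eq_mul₀ hG, ← mul_assoc, hr, div_mul_cancel₀ _ hsin]
    rw [this, norm_div, norm_mul, Complex.norm_real, Real.norm_of_nonneg pi_pos.le]
    have hb := hC (1 - z) (by simp at h2 ⊢; linarith) (by simp only [Complex.sub_re, Complex.one_re]; linarith)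
    have him : |(1 - z).im| = |z.im| := by simp
    rw [him] at hb
    calc _ ≤ C * rexp (-(θ * |z.im|)) * rexp (π * |z.im|) / π := by
          gcongr
          exact norm_sin_pi_mul_le z
      _ ≤ C * rexp (-(θ * |z.im|)) * rexp (π * |z.im|) :=
          div_le_self (by positivity) (by linarith [pi_gt_three])
      _ = C * rexp ((π - θ) * |z.im|) := by
          rw [mul_assoc, ← Real.exp_add]; ring_nf
  | succ n ih =>
    intro z h1 h2 h3
    push_cast at h2
    rcases le_or_gt z.re (1 / 2 + n) with h | h
    · exact ih z h1 h h3
    · have hn : (0 : ℝ) ≤ n := n.cast_nonneg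
      have him : (z - 1).im = z.im := by simp
      have hre : (z - 1).re = z.re - 1 := by simp
      have hz : z - 1 ≠ 0 := by
        intro h0
        rw [← him, h0] at h3
        norm_num at h3
      have hb := ih (z - 1) (by
        rw [hre]; exact (min_le_right _ _).trans (by linarith)) (by rw [hre]; linarith)
        (by rwa [him])
      have hg : Complex.Gamma z = (z - 1) * Complex.Gamma (z - 1) := by
        conv_lhs => rw [← sub_add_cancel z 1]
        exact Complex.Gamma_add_one _ hz
      rw [hg, mul_inv, norm_mul, norm_inv]
      rw [him] at hb
      have h4 : 1 ≤ ‖z - 1‖ := h3.trans (him ▸ Complex.abs_im_le_norm (z - 1))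
      exact (mul_le_of_le_one_left (norm_nonneg _) (inv_le_one_of_one_le₀ h4)).trans hb

/-- The reciprocal of the Gamma function grows at most exponentially in vertical strips. -/
theorem exists_norm_inv_Gamma_le {a b θ : ℝ} (hθ0 : 0 ≤ θ) (hθ : θ < π / 2) :
    ∃ C, 0 < C ∧ ∀ z : ℂ, a ≤ z.re → z.re ≤ b →
      ‖(Complex.Gamma z)⁻¹‖ ≤ C * rexp ((π - θ) * |z.im|) := by
  obtain ⟨C, hC0, hC⟩ := exists_norm_inv_Gamma_le_of_one_le_im (a := a) hθ0 hθ
  -- `1/Γ` is entire, so compactness handles `|Im z| ≤ 1`.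
  obtain ⟨D, hD⟩ := (isCompact_Icc.reProdIm isCompact_Icc).exists_bound_of_continuousOn
    (s := Icc a b ×ℂ Icc (-1) 1) Complex.differentiable_one_div_Gamma.continuous.continuousOn
  obtain ⟨n, hn⟩ := exists_nat_ge b
  refine ⟨max C D, by positivity, fun z h1 h2 => ?_⟩
  rcases le_total 1 |z.im| with h | h
  · exact (hC n z h1 (by linarith) h).trans (by gcongr; exact le_max_left _ _)
  · refine (hD z ⟨⟨h1, h2⟩, abs_le.1 h⟩).trans ((le_max_right C D).trans ?_)
    refine le_mul_of_one_le_right (by positivity) (Real.one_le_exp ?_)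
    exact mul_nonneg (by linarith) (abs_nonneg _)

/-! ### Kernels that decay exponentially in a strip. -/

/-- `A` is holomorphic on the closed strip `a ≤ Re z ≤ b` and decays exponentially there. -/
structure StripDecay (A : ℂ → ℂ) (a b : ℝ) : Prop where
  diff : ∀ z : ℂ, a ≤ z.re → z.re ≤ b → DifferentiableAt ℂ A z
  bound : ∃ C δ : ℝ, 0 < C ∧ 0 < δ ∧ ∀ z : ℂ, a ≤ z.re → z.re ≤ b →
    ‖A z‖ ≤ C * rexp (-(δ * |z.im|))

theorem StripDecay.mono {A : ℂ → ℂ} {a b a' b' : ℝ} (h : StripDecay A a b) (ha : a ≤ a')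
    (hb : b' ≤ b) : StripDecay A a' b' := by
  obtain ⟨C, δ, hC, hδ, hb'⟩ := h.bound
  exact ⟨fun z h1 h2 => h.diff z (ha.trans h1) (h2.trans hb), C, δ, hC, hδ,
    fun z h1 h2 => hb' z (ha.trans h1) (h2.trans hb)⟩

/-- Half of the decay rate absorbs the linear growth. Affine factors are what differentiation of an
inverse Mellin transform produces. -/
theorem StripDecay.affine_mul {A : ℂ → ℂ} {a b : ℝ} (h : StripDecay A a b) (p q : ℂ) :
    StripDecay (fun z => (p + q * z) * A z) a b := by
  obtain ⟨C, δ, hC, hδ, hb⟩ := h.bound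
  refine ⟨fun z h1 h2 => DifferentiableAt.mul (by fun_prop) (h.diff z h1 h2),
    (‖p‖ + ‖q‖ * (|a| + |b|) + ‖q‖ * (2 / δ) + 1) * C, δ / 2, by positivity, by positivity,
    fun z h1 h2 => ?_⟩
  have hre : |z.re| ≤ |a| + |b| := by
    rw [abs_le]
    constructor
    · linarith [neg_abs_le a, abs_nonneg b]
    · linarith [le_abs_self b, abs_nonneg a]
  have hz : ‖z‖ ≤ (|a| + |b|) + |z.im| := (Complex.norm_le_abs_re_add_abs_im z).trans (by linarith)
  have h3 : ‖p + q * z‖ ≤ ‖p‖ + ‖q‖ * ((|a| + |b|) + |z.im|) := by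
    refine (norm_add_le _ _).trans ?_
    rw [norm_mul]
    gcongr
  have h4 : δ / 2 * |z.im| ≤ rexp (δ / 2 * |z.im|) := by
    linarith [Real.add_one_le_exp (δ / 2 * |z.im|)]
  have h5 : |z.im| ≤ 2 / δ * rexp (δ / 2 * |z.im|) := by
    calc |z.im| = 2 / δ * (δ / 2 * |z.im|) := by field_simp
      _ ≤ _ := by gcongr
  have h6 : 1 ≤ rexp (δ / 2 * |z.im|) := Real.one_le_exp (by positivity)
  have h7 : ‖p + q * z‖ ≤
      (‖p‖ + ‖q‖ * (|a| + |b|) + ‖q‖ * (2 / δ) + 1) * rexp (δ / 2 * |z.im|) := by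
    have h8 : ‖q‖ * |z.im| ≤ ‖q‖ * (2 / δ * rexp (δ / 2 * |z.im|)) := by gcongr
    have h9 : ‖p‖ + ‖q‖ * (|a| + |b|) ≤
      (‖p‖ + ‖q‖ * (|a| + |b|)) * rexp (δ / 2 * |z.im|) :=
      le_mul_of_one_le_right (by positivity) h6
    linarith
  rw [norm_mul]
  calc _ ≤ (‖p‖ + ‖q‖ * (|a| + |b|) + ‖q‖ * (2 / δ) + 1) * rexp (δ / 2 * |z.im|) *
        (C * rexp (-(δ * |z.im|))) := by
        gcongr
        exact hb z h1 h2
    _ = (‖p‖ + ‖q‖ * (|a| + |b|) + ‖q‖ * (2 / δ) + 1) * C *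
        (rexp (δ / 2 * |z.im|) * rexp (-(δ * |z.im|))) := by ring
    _ = _ := by
      rw [← Real.exp_add]
      congr 2
      ring

theorem differentiableAt_Gamma_of_re_pos {z : ℂ} (hz : 0 < z.re) :
    DifferentiableAt ℂ Complex.Gamma z := by
  refine Complex.differentiableAt_Gamma _ fun m hm => ?_
  rw [hm] at hz
  simp at hz
  have : (0 : ℝ) ≤ m := m.cast_nonneg
  linarith

theorem StripDecay.mul_Gamma {A : ℂ → ℂ} {a b q : ℝ} (h : StripDecay A a b) (hq : 0 < q + a) :
    StripDecay (fun z => A z * Complex.Gamma (q + z)) a b := by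
  obtain ⟨C, δ, hC, hδ, hb⟩ := h.bound
  -- Rate `θ = 0`: boundedness of the extra Gamma factor suffices.
  obtain ⟨D, hD0, hD⟩ := exists_norm_Gamma_le (b := q + b) hq le_rfl (half_pos pi_pos)
  refine ⟨fun z h1 h2 => (h.diff z h1 h2).mul ?_, C * D, δ, by positivity, hδ,
    fun z h1 h2 => ?_⟩
  · refine DifferentiableAt.comp z (differentiableAt_Gamma_of_re_pos ?_) (by fun_prop)
    simp; linarith
  · rw [norm_mul, mul_right_comm]
    have := hD (q + z) (by simp; linarith) (by simp; linarith)
    simp at this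
    gcongr
    exact hb z h1 h2

/-- The net decay rate is `θ - (π - θ) ν`, positive exactly when `θ > νπ / (1 + ν)`. Such a `θ`
exists below `π/2` because `ν < 1`. -/
theorem stripDecay_Gamma_div_Gamma {ν : ℝ} (hν : 0 < ν) (hν1 : ν < 1) {p r a b : ℝ}
    (hp : 0 < p + a) :
    StripDecay (fun z => Complex.Gamma (p + z) / Complex.Gamma (r + ν * z)) a b := by
  have hθ : ν * π / (1 + ν) < π / 2 := by
    rw [div_lt_div_iff₀ (by linarith) two_pos]
    nlinarith [pi_pos]
  obtain ⟨θ, h1, h2⟩ := exists_between hθ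
  have h0 : 0 ≤ θ := le_trans (by positivity) h1.le
  rw [div_lt_iff₀ (by linarith)] at h1
  obtain ⟨C, hC0, hC⟩ := exists_norm_Gamma_le (b := p + b) hp h0 h2
  obtain ⟨D, hD0, hD⟩ := exists_norm_inv_Gamma_le (a := r + ν * a) (b := r + ν * b) h0 h2
  refine ⟨fun z h1 h2 => ?_, C * D, θ - (π - θ) * ν, by positivity, by linarith,
    fun z h1 h2 => ?_⟩
  · simp_rw [div_eq_mul_inv]
    refine DifferentiableAt.mul ?_ ?_
    · refine DifferentiableAt.comp z (differentiableAt_Gamma_of_re_pos ?_) (by fun_prop)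
      simp; linarith
    · exact DifferentiableAt.comp z (Complex.differentiable_one_div_Gamma _)
        (f := fun z : ℂ => r + ν * z) (by fun_prop)
  · rw [div_eq_mul_inv, norm_mul]
    have e1 := hC (p + z) (by simp; linarith) (by simp; linarith)
    have e2 := hD (r + ν * z) (by simp; gcongr) (by simp; gcongr)
    have i1 : ((p : ℂ) + z).im = z.im := by simp
    have i2 : |((r : ℂ) + ν * z).im| = ν * |z.im| := by simp [abs_mul, abs_of_pos hν]
    rw [i1] at e1
    rw [i2] at e2
    calc _ ≤ (C * rexp (-(θ * |z.im|))) * (D * rexp ((π - θ) * (ν * |z.im|))) := by gcongr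
      _ = C * D * (rexp (-(θ * |z.im|)) * rexp ((π - θ) * (ν * |z.im|))) := by ring
      _ = _ := by
        rw [← Real.exp_add]
        congr 2
        ring

/-! ### Calculus of the inverse Mellin transform: contour shifts, derivatives, inversion. -/

theorem integrable_exp_neg_mul_abs {δ : ℝ} (hδ : 0 < δ) :
    Integrable fun y : ℝ => rexp (-(δ * |y|)) := by
  have h : IntegrableOn (fun y : ℝ => rexp (-(δ * |y|))) (Ioi 0) := by
    refine (exp_neg_integrableOn_Ioi 0 hδ).congr_fun (fun y hy => ?_) measurableSet_Ioi
    rw [mem_Ioi] at hy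
    simp [abs_of_pos hy]
  have h' : IntegrableOn (fun y : ℝ => rexp (-(δ * |y|))) (Iio 0) := by
    have h0 : IntegrableOn (fun y : ℝ => rexp (-(δ * |y|))) (Ioi (-0)) := by rwa [neg_zero]
    simpa using h0.comp_neg_Iio
  rw [← integrableOn_univ, ← Iic_union_Ioi (a := (0 : ℝ)), integrableOn_union]
  exact ⟨(integrableOn_Iic_iff_integrableOn_Iio (by simp)).2 h', h⟩

theorem StripDecay.continuous_line {A : ℂ → ℂ} {a b c : ℝ} (h : StripDecay A a b) (ha : a ≤ c)
    (hb : c ≤ b) : Continuous fun y : ℝ => A (c + y * Complex.I) := by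
  refine continuous_iff_continuousAt.2 fun y => ?_
  exact ContinuousAt.comp (f := fun y : ℝ => (c + y * Complex.I : ℂ))
    (h.diff _ (by simpa) (by simpa)).continuousAt (by fun_prop)

theorem StripDecay.verticalIntegrable {A : ℂ → ℂ} {a b c : ℝ} (h : StripDecay A a b) (ha : a ≤ c)
    (hb : c ≤ b) : Complex.VerticalIntegrable A c := by
  obtain ⟨C, δ, hC, hδ, hbd⟩ := h.bound
  refine Integrable.mono' ((integrable_exp_neg_mul_abs hδ).const_mul C)
    (h.continuous_line ha hb).aestronglyMeasurable (Eventually.of_forall fun y => ?_)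
  simpa using hbd (c + y * Complex.I) (by simpa) (by simpa)

theorem norm_ofReal_cpow_neg_line {x : ℝ} (hx : 0 < x) (c y : ℝ) :
    ‖(x : ℂ) ^ (-(c + y * Complex.I) : ℂ)‖ = x ^ (-c) := by
  rw [Complex.norm_cpow_eq_rpow_re_of_pos hx]
  simp

/-- Combined with moving the line, this controls the behaviour near 0 by a line on the left and near
infinity by a line on the right. -/
theorem norm_mellinInv_le (c : ℝ) (A : ℂ → ℂ) :
    ∃ C, 0 ≤ C ∧ ∀ x, 0 < x → ‖mellinInv c A x‖ ≤ C * x ^ (-c) := by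
  refine ⟨1 / (2 * π) * ∫ y : ℝ, ‖A (c + y * Complex.I)‖,
    mul_nonneg (by positivity) (integral_nonneg fun _ => norm_nonneg _), fun x hx => ?_⟩
  rw [mellinInv, norm_smul, Real.norm_of_nonneg (by positivity), mul_assoc]
  refine mul_le_mul_of_nonneg_left ((norm_integral_le_integral_norm _).trans (le_of_eq ?_))
    (by positivity)
  simp_rw [norm_smul, norm_ofReal_cpow_neg_line hx]
  rw [integral_const_mul, mul_comm]

theorem continuous_ofReal_cpow_neg_line {x : ℝ} (hx : 0 < x) (c : ℝ) :
    Continuous fun y : ℝ => (x : ℂ) ^ (-(c + y * Complex.I) : ℂ) := by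
  have : (x : ℂ) ≠ 0 := by exact_mod_cast hx.ne'
  exact Continuous.const_cpow (by fun_prop) (Or.inl this)

theorem integrable_cpow_smul_line {A : ℂ → ℂ} {c : ℝ} (h : Complex.VerticalIntegrable A c)
    {x : ℝ} (hx : 0 < x) :
    Integrable fun y : ℝ => (x : ℂ) ^ (-(c + y * Complex.I) : ℂ) • A (c + y * Complex.I) := by
  refine Integrable.bdd_smul h (x ^ (-c))
    (continuous_ofReal_cpow_neg_line hx c).aestronglyMeasurable (Eventually.of_forall fun y => ?_)
  rw [norm_ofReal_cpow_neg_line hx]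

/-- The line of integration of an inverse Mellin transform can be moved. -/
theorem StripDecay.mellinInv_eq {A : ℂ → ℂ} {a b : ℝ} (h : StripDecay A a b) (hab : a ≤ b)
    {x : ℝ} (hx : 0 < x) : mellinInv a A x = mellinInv b A x := by
  set f : ℂ → ℂ := fun z => (x : ℂ) ^ (-z) • A z with hf
  have hx0 : (x : ℂ) ≠ 0 := by exact_mod_cast hx.ne'
  -- Cauchy's theorem on `[a,b] × [-T,T]`; the horizontal sides vanish as `T → ∞`, the vertical ones
  -- tend to the two line integrals.
  have hrect : ∀ T : ℝ, (∫ u : ℝ in a..b, f (u + (-T : ℝ) * Complex.I)) -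
      (∫ u : ℝ in a..b, f (u + T * Complex.I)) +
      Complex.I • (∫ y : ℝ in (-T)..T, f (b + y * Complex.I)) -
      Complex.I • (∫ y : ℝ in (-T)..T, f (a + y * Complex.I)) = 0 := by
    intro T
    refine Complex.integral_boundary_rect_eq_zero_of_differentiableOn f ⟨a, -T⟩ ⟨b, T⟩ ?_
    rintro z ⟨hz, -⟩
    simp only [uIcc_of_le hab, mem_preimage, mem_Icc] at hz
    refine DifferentiableAt.differentiableWithinAt
      (DifferentiableAt.fun_smul ?_ (h.diff z hz.1 hz.2))
    exact DifferentiableAt.const_cpow (by fun_prop) (Or.inl hx0)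
  have hlim : ∀ c, a ≤ c → c ≤ b → Tendsto (fun T : ℝ => ∫ y : ℝ in (-T)..T, f (c + y * Complex.I))
      atTop (𝓝 (∫ y : ℝ, f (c + y * Complex.I))) := fun c h1 h2 =>
    intervalIntegral_tendsto_integral
      (integrable_cpow_smul_line (h.verticalIntegrable h1 h2) hx) tendsto_neg_atTop_atBot
      tendsto_id
  obtain ⟨C, δ, hC, hδ, hb⟩ := h.bound
  obtain ⟨M, hM⟩ := isCompact_Icc.exists_bound_of_continuousOn (s := Icc a b)
    (f := fun u : ℝ => x ^ (-u)) (by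
      refine Continuous.continuousOn ?_
      exact (Real.continuous_const_rpow hx.ne').comp continuous_neg)
  -- The sign `ε = ±1` treats the top and bottom sides together.
  have hside : ∀ ε : ℝ, |ε| = 1 → Tendsto
      (fun T : ℝ => ∫ u : ℝ in a..b, f (u + (ε * T : ℝ) * Complex.I)) atTop (𝓝 0) := by
    intro ε hε
    have hlim0 : Tendsto (fun T : ℝ => M * (C * rexp (-(δ * |T|))) * |b - a|) atTop (𝓝 0) := by
      have h1 : Tendsto (fun T : ℝ => δ * |T|) atTop atTop :=
        tendsto_abs_atTop_atTop.const_mul_atTop hδ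
      have := ((Real.tendsto_exp_neg_atTop_nhds_zero.comp h1).const_mul C).const_mul M
      simpa using this.mul_const |b - a|
    refine squeeze_zero_norm (fun T => ?_) hlim0
    refine intervalIntegral.norm_integral_le_of_norm_le_const fun u hu => ?_
    rw [uIoc_of_le hab] at hu
    rw [hf]
    simp only [norm_smul]
    have h1 : ‖(x : ℂ) ^ (-((u : ℂ) + (ε * T : ℝ) * Complex.I))‖ ≤ M := by
      rw [norm_ofReal_cpow_neg_line hx]
      exact (le_abs_self _).trans (hM u ⟨hu.1.le, hu.2⟩)
    have h2 := hb (u + (ε * T : ℝ) * Complex.I) (by simpa using hu.1.le) (by simpa using hu.2)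
    have h3 : |((u : ℂ) + (ε * T : ℝ) * Complex.I).im| = |T| := by
      simp [abs_mul, hε]
    rw [h3] at h2
    exact mul_le_mul h1 h2 (norm_nonneg _) ((norm_nonneg _).trans h1)
  have key := (((hside (-1) (by simp)).sub (hside 1 (by simp))).add
    ((hlim b hab le_rfl).const_smul Complex.I)).sub ((hlim a le_rfl hab).const_smul Complex.I)
  have hzero : (0 : ℂ) - 0 + Complex.I • (∫ y : ℝ, f (b + y * Complex.I)) -
      Complex.I • (∫ y : ℝ, f (a + y * Complex.I)) = 0 := by
    refine tendsto_nhds_unique key (tendsto_const_nhds.congr fun T => ?_)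
    have := hrect T
    simp only [neg_mul, one_mul] at this ⊢
    exact this.symm
  have h2 : (∫ y : ℝ, f (a + y * Complex.I)) = ∫ y : ℝ, f (b + y * Complex.I) := by
    have h3 : Complex.I * (∫ y : ℝ, f (b + y * Complex.I)) =
        Complex.I * (∫ y : ℝ, f (a + y * Complex.I)) := by
      simp only [smul_eq_mul, sub_zero, zero_add] at hzero
      exact sub_eq_zero.1 hzero
    exact (mul_left_cancel₀ Complex.I_ne_zero h3).symm
  rw [mellinInv, mellinInv]
  exact congrArg _ h2

theorem hasDerivAt_ofReal_cpow {x : ℝ} (hx : 0 < x) (s : ℂ) :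
    HasDerivAt (fun x : ℝ => (x : ℂ) ^ s) (s * (x : ℂ) ^ (s - 1)) x := by
  have := ((hasDerivAt_id' (x : ℂ)).cpow_const (c := s)
    (Or.inl (by simpa using hx))).comp_ofReal
  simpa using this

theorem StripDecay.hasDerivAt_mellinInv {A : ℂ → ℂ} {c : ℝ} (h : StripDecay A c c) {x : ℝ}
    (hx : 0 < x) :
    HasDerivAt (mellinInv c A) (-(mellinInv c (fun z => z * A z) x) / x) x := by
  have hzA : StripDecay (fun z => z * A z) c c := by simpa using h.affine_mul 0 1
  have hxm : Metric.ball x (x / 2) ∈ 𝓝 x := Metric.ball_mem_nhds x (half_pos hx)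
  have hball : ∀ u ∈ Metric.ball x (x / 2), u ∈ Icc (x / 2) (2 * x) := by
    intro u hu
    rw [Metric.mem_ball, Real.dist_eq, abs_lt] at hu
    exact ⟨by linarith, by linarith⟩
  obtain ⟨M, hM⟩ := isCompact_Icc.exists_bound_of_continuousOn (s := Icc (x / 2) (2 * x))
    (f := fun u : ℝ => u ^ (-c - 1)) (by
      intro u hu
      exact (Real.continuousAt_rpow_const _ _
        (Or.inl (by linarith [hu.1] : (0:ℝ) < u).ne')).continuousWithinAt)
  have hvi := h.verticalIntegrable le_rfl le_rfl
  have hvi' := hzA.verticalIntegrable le_rfl le_rfl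
  have hmain := (hasDerivAt_integral_of_dominated_loc_of_deriv_le
    (F := fun (u y : ℝ) => (u : ℂ) ^ (-(c + y * Complex.I) : ℂ) • A (c + y * Complex.I))
    (F' := fun (u y : ℝ) => (-(c + y * Complex.I) * (u : ℂ) ^ (-(c + y * Complex.I) - 1 : ℂ)) •
      A (c + y * Complex.I))
    (bound := fun y : ℝ => M * ‖(c + y * Complex.I) * A (c + y * Complex.I)‖) (μ := volume)
    hxm ?_ (integrable_cpow_smul_line hvi hx) ?_ ?_ (hvi'.norm.const_mul M) ?_).2
  · have h2 := hmain.const_mul (1 / (2 * π) : ℂ)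
    have e1 : (fun u : ℝ => (1 / (2 * π) : ℂ) * ∫ y : ℝ, (u : ℂ) ^ (-(c + y * Complex.I) : ℂ) •
        A (c + y * Complex.I)) = mellinInv c A := by
      ext u
      rw [mellinInv, Complex.real_smul]
      push_cast
      rfl
    rw [e1] at h2
    refine h2.congr_deriv ?_
    have hx0 : (x : ℂ) ≠ 0 := by exact_mod_cast hx.ne'
    have e2 : ∀ y : ℝ, (-(c + y * Complex.I) * (x : ℂ) ^ (-(c + y * Complex.I) - 1 : ℂ)) •
        A (c + y * Complex.I) = (-1 / x : ℂ) * ((x : ℂ) ^ (-(c + y * Complex.I) : ℂ) •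
        ((c + y * Complex.I) * A (c + y * Complex.I))) := by
      intro y
      rw [Complex.cpow_sub _ _ hx0, Complex.cpow_one]
      simp only [smul_eq_mul]
      field_simp
    simp_rw [e2]
    rw [integral_const_mul, mellinInv, Complex.real_smul]
    push_cast
    ring
  · filter_upwards [lt_mem_nhds hx] with u hu
    exact (integrable_cpow_smul_line hvi hu).aestronglyMeasurable
  · have hx0 : (x : ℂ) ≠ 0 := by exact_mod_cast hx.ne'
    refine Continuous.aestronglyMeasurable ?_
    refine Continuous.smul (Continuous.mul (by fun_prop)
      (Continuous.const_cpow (by fun_prop) (Or.inl hx0))) (h.continuous_line le_rfl le_rfl)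
  · refine Eventually.of_forall fun y u hu => ?_
    have hu' := hball u hu
    have hu0 : 0 < u := by linarith [hu'.1]
    rw [norm_smul, norm_mul, norm_neg, norm_mul, Complex.norm_cpow_eq_rpow_re_of_pos hu0]
    have h1 := (le_abs_self _).trans (hM u hu')
    have h2 : (-((c : ℂ) + y * Complex.I) - 1).re = -c - 1 := by simp
    rw [h2, mul_comm ‖(c : ℂ) + y * Complex.I‖, mul_assoc]
    gcongr
  · refine Eventually.of_forall fun y u hu => ?_
    have hu0 : 0 < u := by linarith [(hball u hu).1]
    exact (hasDerivAt_ofReal_cpow hu0 _).smul_const _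

/-- Under the integral, `y^p (k y^q)^(-z)` is a constant times `y^(p - qz)`. Every derivative in `x`
or `t` of the solution and of its fractional integral is an instance. -/
theorem StripDecay.hasDerivAt_rpow_mul_mellinInv {A : ℂ → ℂ} {c : ℝ} (h : StripDecay A c c)
    {k y : ℝ} (hk : 0 < k) (hy : 0 < y) (p q : ℝ) :
    HasDerivAt (fun y : ℝ => ((y ^ p : ℝ) : ℂ) * mellinInv c A (k * y ^ q))
      (((y ^ (p - 1) : ℝ) : ℂ) * mellinInv c (fun z => (p + (-q) * z) * A z) (k * y ^ q)) y := by
  have hX : 0 < k * y ^ q := by positivity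
  have h1 : HasDerivAt (fun y : ℝ => k * y ^ q) (k * (q * y ^ (q - 1))) y :=
    (Real.hasDerivAt_rpow_const (Or.inl hy.ne')).const_mul k
  have h2 := (h.hasDerivAt_mellinInv hX).scomp y h1
  have h3 := (Real.hasDerivAt_rpow_const (x := y) (p := p) (Or.inl hy.ne')).ofReal_comp
  refine (h3.mul h2).congr_deriv ?_
  have hvi := h.verticalIntegrable le_rfl le_rfl
  have hzA : StripDecay (fun z => z * A z) c c := by simpa using h.affine_mul 0 1
  have hvi' := hzA.verticalIntegrable le_rfl le_rfl
  have hlin : mellinInv c (fun z => (p + (-q) * z) * A z) (k * y ^ q) =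
      p * mellinInv c A (k * y ^ q) - q * mellinInv c (fun z => z * A z) (k * y ^ q) := by
    simp only [mellinInv, Complex.real_smul]
    rw [mul_left_comm, mul_left_comm (q : ℂ), ← mul_sub]
    congr 1
    rw [← integral_const_mul, ← integral_const_mul, ← integral_sub]
    · congr 1 with v
      simp only [smul_eq_mul]
      ring
    · exact (integrable_cpow_smul_line hvi hX).const_mul _
    · exact (integrable_cpow_smul_line hvi' hX).const_mul _
  rw [hlin]
  have hk0 : (k : ℂ) ≠ 0 := by exact_mod_cast hk.ne'
  have hy0 : (y : ℂ) ≠ 0 := by exact_mod_cast hy.ne'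
  have hyq : ((y ^ q : ℝ) : ℂ) ≠ 0 := by exact_mod_cast (Real.rpow_pos_of_pos hy q).ne'
  rw [Real.rpow_sub_one hy.ne', Real.rpow_sub_one hy.ne']
  simp only [Complex.real_smul, Function.comp_apply]
  push_cast
  field_simp
  ring

theorem StripDecay.contDiffOn_mellinInv {c : ℝ} (n : ℕ) {A : ℂ → ℂ} (h : StripDecay A c c) :
    ContDiffOn ℝ n (mellinInv c A) (Ioi 0) := by
  induction n generalizing A with
  | zero =>
    rw [Nat.cast_zero, contDiffOn_zero]
    exact fun x hx => (h.hasDerivAt_mellinInv hx).continuousAt.continuousWithinAt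
  | succ n ih =>
    have hzA : StripDecay (fun z => z * A z) c c := by simpa using h.affine_mul 0 1
    push_cast
    rw [contDiffOn_succ_iff_deriv_of_isOpen isOpen_Ioi]
    refine ⟨fun x hx => (h.hasDerivAt_mellinInv hx).differentiableAt.differentiableWithinAt,
      by simp, ?_⟩
    have hinv : ContDiffOn ℝ n (fun x : ℝ => (x : ℂ)⁻¹) (Ioi 0) := by
      refine ContDiffOn.inv (Complex.ofRealCLM.contDiff.contDiffOn) fun x hx => ?_
      exact_mod_cast (ne_of_gt hx)
    refine ((ih hzA).neg.mul hinv).congr fun x hx => ?_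
    rw [(h.hasDerivAt_mellinInv hx).deriv, div_eq_mul_inv]

open scoped FourierTransform in
/-- The Mellin transform inverts the inverse Mellin transform. -/
theorem StripDecay.mellin_mellinInv {A : ℂ → ℂ} {a b c : ℝ} (h : StripDecay A a b) (ha : a < c)
    (hb : c < b) : mellin (mellinInv c A) c = A c := by
  -- With `x = exp(-u)` the transform becomes an inverse Fourier transform; `2π` comes from the
  -- Fourier normalisation.
  set F : ℝ → ℂ := fun y => A (c + 2 * π * y * Complex.I) with hF
  have hFeq : F = fun y : ℝ => (fun v : ℝ => A (c + v * Complex.I)) (y * (2 * π)) := by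
    ext y
    simp only [hF]
    push_cast
    ring_nf
  have hvi := h.verticalIntegrable ha.le hb.le
  have hFc : Continuous F := by
    rw [hFeq]
    exact (h.continuous_line ha.le hb.le).comp (by fun_prop)
  have hFi : Integrable F := by
    rw [hFeq]
    exact hvi.comp_mul_right' (by positivity)
  have hinv : ∀ u : ℝ, 𝓕⁻ F u = rexp (-c * u) • mellinInv c A (rexp (-u)) := by
    intro u
    rw [mellinInv_eq_fourierInv _ _ (exp_pos _), Real.log_exp, neg_neg, Complex.real_smul,
      smul_eq_mul, ← mul_assoc]
    have h1 : ((rexp (-c * u) : ℝ) : ℂ) * ((rexp (-u) : ℝ) : ℂ) ^ (-c : ℂ) = 1 := by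
      rw [← Complex.ofReal_neg, ← Complex.ofReal_cpow (exp_pos _).le, ← Complex.ofReal_mul,
        ← Real.exp_mul, ← Real.exp_add, show -c * u + -u * -c = 0 by ring, Real.exp_zero,
        Complex.ofReal_one]
    rw [h1, one_mul]
  have hcont : Continuous (𝓕⁻ F) := by
    rw [funext hinv]
    have he : Continuous fun u : ℝ => rexp (-c * u) := by fun_prop
    refine he.smul (continuous_iff_continuousAt.2 fun u => ?_)
    exact ContinuousAt.comp (f := fun u : ℝ => rexp (-u))
      ((h.mono ha.le hb.le).hasDerivAt_mellinInv (exp_pos _)).continuousAt (by fun_prop)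
  obtain ⟨C₁, hC₁, h₁⟩ := norm_mellinInv_le a A
  obtain ⟨C₂, hC₂, h₂⟩ := norm_mellinInv_le b A
  -- Decay in `u` comes from moving the line to `a` for `u ≥ 0` and to `b` for `u ≤ 0`; hence `c`
  -- must be interior.
  have hint : Integrable (𝓕⁻ F) := by
    have hδ : 0 < min (c - a) (b - c) := lt_min (by linarith) (by linarith)
    refine Integrable.mono' ((integrable_exp_neg_mul_abs hδ).const_mul (max C₁ C₂))
      hcont.aestronglyMeasurable (Eventually.of_forall fun u => ?_)
    rw [hinv, norm_smul, Real.norm_of_nonneg (exp_pos _).le]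
    rcases le_total 0 u with hu | hu
    · rw [← (h.mono le_rfl hb.le).mellinInv_eq ha.le (exp_pos _)]
      calc _ ≤ rexp (-c * u) * (C₁ * rexp (-u) ^ (-a)) := by gcongr; exact h₁ _ (exp_pos _)
        _ = C₁ * rexp (-((c - a) * u)) := by
          rw [← Real.exp_mul, mul_left_comm, ← Real.exp_add]
          ring_nf
        _ ≤ _ := by
          rw [abs_of_nonneg hu]
          gcongr
          · exact le_max_left _ _
          · exact min_le_left _ _
    · rw [(h.mono ha.le le_rfl).mellinInv_eq hb.le (exp_pos _)]
      calc _ ≤ rexp (-c * u) * (C₂ * rexp (-u) ^ (-b)) := by gcongr; exact h₂ _ (exp_pos _)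
        _ = C₂ * rexp (-((b - c) * -u)) := by
          rw [← Real.exp_mul, mul_left_comm, ← Real.exp_add]
          ring_nf
        _ ≤ _ := by
          rw [abs_of_nonpos hu]
          have := neg_nonneg.2 hu
          gcongr
          · exact le_max_right _ _
          · exact min_le_right _ _
  rw [mellin_eq_fourier]
  have h3 : (fun u : ℝ => rexp (-(c : ℂ).re * u) • mellinInv c A (rexp (-u))) = 𝓕⁻ F := by
    ext u
    rw [hinv u, Complex.ofReal_re]
  have hint' : Integrable (𝓕 F) := by
    refine hint.comp_neg.congr (Eventually.of_forall fun v => ?_)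
    simp only [Real.fourierInv_eq_fourier_neg, neg_neg]
  rw [h3, hFc.fourier_fourierInv_eq hFi hint']
  simp [hF]

theorem StripDecay.continuousOn_mellinInv {A : ℂ → ℂ} {c : ℝ} (h : StripDecay A c c) :
    ContinuousOn (mellinInv c A) (Ioi 0) :=
  fun _ hx => (h.hasDerivAt_mellinInv hx).continuousAt.continuousWithinAt

/-- The bound `x^(-a)` with `a < 1` is integrable at 0, and `x^(-b)` with `b > 1` at infinity. -/
theorem StripDecay.integrableOn_mellinInv {A : ℂ → ℂ} {a b c : ℝ} (h : StripDecay A a b)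
    (hac : a ≤ c) (hcb : c ≤ b) (ha : a < 1) (hb : 1 < b) :
    IntegrableOn (mellinInv c A) (Ioi 0) := by
  have hmeas : AEStronglyMeasurable (mellinInv c A) (volume.restrict (Ioi 0)) :=
    (h.mono hac hcb).continuousOn_mellinInv.aestronglyMeasurable measurableSet_Ioi
  obtain ⟨C₁, hC₁, h₁⟩ := norm_mellinInv_le a A
  obtain ⟨C₂, hC₂, h₂⟩ := norm_mellinInv_le b A
  rw [← Ioc_union_Ioi_eq_Ioi zero_le_one, integrableOn_union]
  constructor
  · have hi : IntegrableOn (fun x : ℝ => C₁ * x ^ (-a)) (Ioc 0 1) := by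
      have := intervalIntegral.intervalIntegrable_rpow' (a := 0) (b := 1) (r := -a) (by linarith)
      rw [intervalIntegrable_iff_integrableOn_Ioc_of_le zero_le_one] at this
      exact this.const_mul _
    refine Integrable.mono' hi (hmeas.mono_measure
      (Measure.restrict_mono Ioc_subset_Ioi_self le_rfl)) ?_
    filter_upwards [ae_restrict_mem measurableSet_Ioc] with x hx
    rw [← (h.mono le_rfl hcb).mellinInv_eq hac hx.1]
    exact h₁ x hx.1
  · have hi : IntegrableOn (fun x : ℝ => C₂ * x ^ (-b)) (Ioi 1) :=
      (integrableOn_Ioi_rpow_of_lt (by linarith) one_pos).const_mul _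
    refine Integrable.mono' hi (hmeas.mono_measure
      (Measure.restrict_mono (Ioi_subset_Ioi zero_le_one) le_rfl)) ?_
    filter_upwards [ae_restrict_mem measurableSet_Ioi] with x hx
    have hx0 : 0 < x := one_pos.trans hx
    rw [(h.mono hac le_rfl).mellinInv_eq hcb hx0]
    exact h₂ x hx0

/-- Integration against an inverse Mellin transform can be carried out under the contour
integral. -/
theorem integral_mul_mellinInv {α : Type*} [MeasurableSpace α] {m : Measure α} [SFinite m]
    {F : α → ℂ} {k : α → ℝ} {A : ℂ → ℂ} {c : ℝ} (hk : Measurable k) (hpos : ∀ᵐ s ∂m, 0 < k s)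
    (hF : Integrable (fun s => F s * ((k s ^ (-c) : ℝ) : ℂ)) m)
    (hA : Complex.VerticalIntegrable A c) :
    Integrable (fun s => F s * mellinInv c A (k s)) m ∧
      ∫ s, F s * mellinInv c A (k s) ∂m = (1 / (2 * π) : ℝ) •
        ∫ y : ℝ, A (c + y * Complex.I) *
          ∫ s, F s * (k s : ℂ) ^ (-(c + y * Complex.I) : ℂ) ∂m := by
  have hprod : Integrable (fun p : α × ℝ => F p.1 * ((k p.1 : ℂ) ^ (-(c + p.2 * Complex.I) : ℂ) *
      A (c + p.2 * Complex.I))) (m.prod volume) := by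
    have h1 := hF.mul_prod hA
    have hmeas : Measurable fun p : α × ℝ => (k p.1 : ℂ) ^ (-(p.2 * Complex.I) : ℂ) := by
      refine Measurable.pow (Complex.measurable_ofReal.comp (hk.comp measurable_fst)) (by fun_prop)
    have hae : ∀ᵐ p ∂(m.prod (volume : Measure ℝ)), 0 < k p.1 :=
      Measure.quasiMeasurePreserving_fst.ae hpos
    -- Since `|k^(-iy)| = 1`, the double integrand differs from the tensor product of `F k^(-c)` and
    -- `A` by a factor of modulus one, so Fubini applies.
    refine (Integrable.bdd_mul (c := 1) h1 hmeas.aestronglyMeasurable ?_).congr ?_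
    · filter_upwards [hae] with p hp
      rw [Complex.norm_cpow_eq_rpow_re_of_pos hp]
      simp
    · filter_upwards [hae] with p hp
      have hp0 : (k p.1 : ℂ) ≠ 0 := by exact_mod_cast hp.ne'
      rw [neg_add, Complex.cpow_add _ _ hp0, Complex.ofReal_cpow hp.le]
      push_cast
      ring
  have e : ∀ s, F s * mellinInv c A (k s) = (1 / (2 * π) : ℝ) •
      ∫ y : ℝ, F s * ((k s : ℂ) ^ (-(c + y * Complex.I) : ℂ) * A (c + y * Complex.I)) := by
    intro s
    rw [mellinInv, integral_const_mul]
    simp only [Complex.real_smul, smul_eq_mul]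
    ring
  simp_rw [e]
  refine ⟨hprod.integral_prod_left.fun_smul _, ?_⟩
  rw [integral_smul, integral_integral_swap hprod]
  congr 2 with y
  rw [← integral_const_mul]
  congr 1 with s
  ring

theorem mellinInv_congr {A B : ℂ → ℂ} {c : ℝ} (h : ∀ z : ℂ, z.re = c → A z = B z) (x : ℝ) :
    mellinInv c A x = mellinInv c B x := by
  simp only [mellinInv]
  congr 2 with y
  rw [h _ (by simp)]

theorem mellinInv_const_mul (k : ℂ) (A : ℂ → ℂ) (c x : ℝ) :
    mellinInv c (fun z => k * A z) x = k * mellinInv c A x := by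
  simp only [mellinInv, Complex.real_smul, smul_eq_mul]
  simp_rw [mul_left_comm _ k]
  rw [integral_const_mul, mul_left_comm]

theorem mellinInv_sub_one (A : ℂ → ℂ) (c : ℝ) {x : ℝ} (hx : 0 < x) :
    mellinInv (c - 1) A x = x * mellinInv c (fun z => A (z - 1)) x := by
  have hx0 : (x : ℂ) ≠ 0 := by exact_mod_cast hx.ne'
  simp only [mellinInv, Complex.real_smul, smul_eq_mul]
  rw [mul_left_comm (x : ℂ), ← integral_const_mul (x : ℂ)]
  congr 2 with y
  have h1 : ((c - 1 : ℝ) : ℂ) + y * Complex.I = c + y * Complex.I - 1 := by push_cast; ring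
  rw [h1, neg_sub, sub_eq_add_neg, Complex.cpow_add _ _ hx0, Complex.cpow_one, mul_assoc]

/-! ### The Mellin–Barnes representation of the solution. -/

theorem ofReal_div_cpow {a b : ℝ} (ha : 0 < a) (hb : 0 < b) (z : ℂ) :
    ((a / b : ℝ) : ℂ) ^ z = (a : ℂ) ^ z * (b : ℂ) ^ (-z) := by
  have ha0 : (a : ℂ) ≠ 0 := by exact_mod_cast ha.ne'
  have hb0 : (b : ℂ) ≠ 0 := by exact_mod_cast hb.ne'
  have hab : ((a / b : ℝ) : ℂ) ≠ 0 := by exact_mod_cast (div_pos ha hb).ne'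
  rw [Complex.cpow_def_of_ne_zero ha0, Complex.cpow_def_of_ne_zero hb0,
    Complex.cpow_def_of_ne_zero hab, ← Complex.ofReal_log ha.le, ← Complex.ofReal_log hb.le,
    ← Complex.ofReal_log (div_pos ha hb).le, Real.log_div ha.ne' hb.ne', ← Complex.exp_add]
  push_cast
  ring_nf

theorem ofReal_rpow_cpow {a : ℝ} (ha : 0 < a) (p : ℝ) (z : ℂ) :
    ((a ^ p : ℝ) : ℂ) ^ z = (a : ℂ) ^ (p * z) := by
  have ha0 : (a : ℂ) ≠ 0 := by exact_mod_cast ha.ne'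
  have hb0 : ((a ^ p : ℝ) : ℂ) ≠ 0 := by exact_mod_cast (Real.rpow_pos_of_pos ha p).ne'
  rw [Complex.cpow_def_of_ne_zero ha0, Complex.cpow_def_of_ne_zero hb0, ← Complex.ofReal_log ha.le,
    ← Complex.ofReal_log (Real.rpow_pos_of_pos ha p).le, Real.log_rpow ha]
  push_cast
  ring_nf

/-- The substitution `s ↦ 1/s` reduces this to the Gamma integral. -/
theorem integrableOn_cpow_mul_cexp_neg_div {a : ℂ} (ha : 0 < a.re) {w : ℝ} (hw : 0 < w) :
    IntegrableOn (fun s : ℝ => (s : ℂ) ^ (-a - 1) * Complex.exp (-(w / s))) (Ioi 0) := by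
  have h := (MellinConvergent.comp_rpow (f := fun t : ℝ => Complex.exp (-((w : ℂ) * t)))
    (s := -a) (a := -1) (by norm_num)).2 (by
      rw [Complex.ofReal_neg, Complex.ofReal_one, neg_div_neg_eq, div_one]
      exact integrableOn_cpow_mul_cexp (r := (w : ℂ)) ha (by simpa))
  simpa [MellinConvergent, div_eq_mul_inv, Real.rpow_neg_one] using h

theorem integral_cpow_mul_cexp_neg_div {a : ℂ} (ha : 0 < a.re) {w : ℝ} (hw : 0 < w) :
    ∫ s : ℝ in Ioi 0, (s : ℂ) ^ (-a - 1) * Complex.exp (-(w / s)) =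
      (w : ℂ) ^ (-a) * Complex.Gamma a := by
  have h := mellin_comp_inv (fun t : ℝ => Complex.exp (-((w : ℂ) * t))) (-a)
  rw [neg_neg] at h
  have h2 := integral_cpow_mul_cexp_neg_mul (a := a) (r := (w : ℂ)) ha (by simpa)
  have h3 : (1 / (w : ℂ)) ^ a = (w : ℂ) ^ (-a) := by
    have := ofReal_div_cpow one_pos hw a
    push_cast at this
    rw [this, Complex.one_cpow, one_mul]
  rw [h3] at h2
  rw [← h2]
  simpa [mellin, div_eq_mul_inv] using h

/-- Both signs of `γ` are treated at once from here on, since `sign(γ) γ = |γ|` and time enters only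
through `t^(-μ) exp(-x^γ/t)`. -/
theorem genGammaTilde_eq {γ : ℝ} (hγ : γ ≠ 0) (μ : ℝ) {x t : ℝ} (hx : 0 < x) (ht : 0 < t) :
    genGammaTilde γ μ x t =
      |γ| / Real.Gamma μ * x ^ (γ * μ - 1) * (t ^ (-μ) * rexp (-(x ^ γ / t))) := by
  have h1 : (x / t ^ (1 / γ)) ^ γ = x ^ γ / t := by
    rw [Real.div_rpow hx.le (by positivity), ← Real.rpow_mul ht.le, one_div_mul_cancel hγ,
      Real.rpow_one]
  have h2 : (x / t ^ (1 / γ)) ^ (γ * μ - 1) = x ^ (γ * μ - 1) * (t ^ (-μ) * t ^ (1 / γ)) := by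
    rw [Real.div_rpow hx.le (by positivity), ← Real.rpow_mul ht.le, div_eq_mul_inv,
      ← Real.rpow_neg ht.le, ← Real.rpow_add ht]
    congr 2
    field_simp
    ring
  have h3 : Real.sign γ * γ = |γ| := by
    rcases hγ.lt_or_gt with h | h
    · rw [Real.sign_of_neg h, abs_of_neg h, neg_one_mul]
    · rw [Real.sign_of_pos h, abs_of_pos h, one_mul]
  rw [genGammaTilde, genGamma, genGammaQ, h1, h2, ← h3]
  have : t ^ (1 / γ) ≠ 0 := by positivity
  field_simp

theorem invStableKernel_eq (ν : ℝ) (η : ℂ) :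
    invStableKernel ν η = Complex.Gamma η / Complex.Gamma (1 - ν + ν * η) := by
  simp [invStableKernel, foxKernel, mul_comm]

theorem stripDecay_invStableKernel {ν : ℝ} (hν : 0 < ν) (hν1 : ν < 1) {a b : ℝ} (ha : 0 < a) :
    StripDecay (invStableKernel ν) a b := by
  have h := stripDecay_Gamma_div_Gamma hν hν1 (p := 0) (r := 1 - ν) (a := a) (b := b) (by simpa)
  convert! h using 2 with z
  rw [invStableKernel_eq]
  simp

/-- The Mellin transform of the solution, in the similarity variable `x ^ γ / t ^ ν`. -/
noncomputable def solKernel (μ ν : ℝ) (z : ℂ) : ℂ :=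
  Complex.Gamma ((1 : ℝ) + z) / Complex.Gamma ((1 : ℝ) + ν * z) * Complex.Gamma (μ + z)

theorem stripDecay_solKernel {μ ν : ℝ} (hν : 0 < ν) (hν1 : ν < 1) {a b : ℝ} (ha : 0 < 1 + a)
    (hμ : 0 < μ + a) : StripDecay (solKernel μ ν) a b :=
  (stripDecay_Gamma_div_Gamma hν hν1 ha).mul_Gamma hμ

/-- On the line `η = 1 + z` with `Re z = 0`, the inner integral of `s^(-μ-1-z) exp(-w/s)` is
`w^(-μ-z) Γ(μ+z)`, and the kernel of `l_ν` becomes `Γ(1+z) / Γ(1+νz)`. -/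
theorem fracSol_aux {γ μ ν : ℝ} (hγ : γ ≠ 0) (hμ : 0 < μ) (hν : 0 < ν) (hν1 : ν < 1) {x t : ℝ}
    (hx : 0 < x) (ht : 0 < t) :
    IntegrableOn (fun s => genGammaTilde γ μ x s * invStableDensity ν s t) (Ioi 0) ∧
    ∫ s in Ioi (0 : ℝ), genGammaTilde γ μ x s * invStableDensity ν s t =
      |γ| / Real.Gamma μ / x * (mellinInv 0 (solKernel μ ν) (x ^ γ / t ^ ν)).re := by
  set τ := t ^ ν with hτ
  have hτ0 : 0 < τ := by positivity
  set w := x ^ γ with hw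
  have hw0 : 0 < w := by positivity
  set C := |γ| / Real.Gamma μ * x ^ (γ * μ - 1) with hC
  set F : ℝ → ℂ := fun s => ((C * (s ^ (-μ) * rexp (-(w / s))) * (1 / τ) : ℝ) : ℂ) with hF
  have hK := stripDecay_invStableKernel hν hν1 (a := 1) (b := 1) one_pos
  have hpow : ∀ s : ℝ, 0 < s → ∀ y : ℝ, F s * ((s / τ : ℝ) : ℂ) ^ (-((1 : ℝ) + y * Complex.I) : ℂ)
      = (C * (τ : ℂ) ^ (y * Complex.I)) *
        ((s : ℂ) ^ (-(μ + y * Complex.I) - 1) * Complex.exp (-(w / s))) := by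
    intro s hs y
    have hs0 : (s : ℂ) ≠ 0 := by exact_mod_cast hs.ne'
    have ht0 : (τ : ℂ) ≠ 0 := by exact_mod_cast hτ0.ne'
    rw [ofReal_div_cpow hs hτ0, neg_neg, Complex.ofReal_one, Complex.cpow_add _ _ ht0,
      Complex.cpow_one, hF,
      show (-(μ + y * Complex.I) - 1 : ℂ) = (-μ : ℝ) + -(1 + y * Complex.I) by push_cast; ring,
      Complex.cpow_add _ _ hs0, ← Complex.ofReal_cpow hs.le]
    push_cast
    field_simp
  have hre : ∀ y : ℝ, 0 < ((μ : ℂ) + y * Complex.I).re := by intro y; simpa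
  have hFint : Integrable (fun s => F s * (((s / τ) ^ (-(1 : ℝ)) : ℝ) : ℂ))
      (volume.restrict (Ioi 0)) := by
    refine ((integrableOn_cpow_mul_cexp_neg_div (hre 0) hw0).const_mul
      (C * (τ : ℂ) ^ ((0 : ℝ) * Complex.I))).congr ?_
    filter_upwards [ae_restrict_mem measurableSet_Ioi] with s hs
    rw [← hpow s hs, Complex.ofReal_cpow (div_pos hs hτ0).le]
    simp
  obtain ⟨h1, h2⟩ := integral_mul_mellinInv (m := volume.restrict (Ioi 0)) (k := fun s : ℝ => s / τ)
    (by fun_prop) (by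
      filter_upwards [ae_restrict_mem measurableSet_Ioi] with s hs
      exact div_pos hs hτ0) hFint (hK.verticalIntegrable le_rfl le_rfl)
  have hintegrand : ∀ s ∈ Ioi (0 : ℝ), (F s * mellinInv 1 (invStableKernel ν) (s / τ)).re =
      genGammaTilde γ μ x s * invStableDensity ν s t := by
    intro s hs
    rw [genGammaTilde_eq hγ μ hx hs, hF, Complex.re_ofReal_mul, invStableDensity]
    change _ = _ * (1 / τ * (mellinInv 1 (invStableKernel ν) (s / τ)).re)
    ring
  constructor
  · exact IntegrableOn.congr_fun h1.re hintegrand measurableSet_Ioi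
  rw [← setIntegral_congr_fun measurableSet_Ioi hintegrand]
  have h3 := Complex.reCLM.integral_comp_comm h1
  simp only [Complex.reCLM_apply] at h3
  rw [h3, h2]
  have hinner : ∀ y : ℝ, ∫ s in Ioi (0 : ℝ), F s * ((s / τ : ℝ) : ℂ) ^
      (-((1 : ℝ) + y * Complex.I) : ℂ) = ((|γ| / Real.Gamma μ / x : ℝ) : ℂ) *
        (((w / τ : ℝ) : ℂ) ^ (-((0 : ℝ) + y * Complex.I) : ℂ) *
          Complex.Gamma (μ + y * Complex.I)) := by
    intro y
    have hw0' : (w : ℂ) ≠ 0 := by exact_mod_cast hw0.ne'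
    rw [setIntegral_congr_fun measurableSet_Ioi (fun s hs => hpow s hs y), integral_const_mul,
      integral_cpow_mul_cexp_neg_div (hre y) hw0, ofReal_div_cpow hw0 hτ0, neg_neg,
      Complex.ofReal_zero, zero_add,
      neg_add, Complex.cpow_add _ _ hw0', ← Complex.ofReal_neg μ, ← Complex.ofReal_cpow hw0.le]
    have h4 : C * w ^ (-μ) = |γ| / Real.Gamma μ / x := by
      rw [hC, hw, ← Real.rpow_mul hx.le, mul_assoc, ← Real.rpow_add hx,
        show γ * μ - 1 + γ * -μ = -1 by ring, Real.rpow_neg_one, ← div_eq_mul_inv]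
    rw [← h4]
    push_cast
    ring
  simp_rw [hinner]
  rw [← Complex.re_ofReal_mul]
  congr 1
  rw [mellinInv, mul_smul_comm, ← integral_const_mul]
  congr 2 with y
  rw [invStableKernel_eq, solKernel]
  have e1 : (1 - ν + ν * (((1 : ℝ) : ℂ) + y * Complex.I) : ℂ) = 1 + ν * (y * Complex.I) := by
    push_cast; ring
  rw [e1]
  simp only [Complex.ofReal_zero, zero_add, Complex.ofReal_one, smul_eq_mul]
  ring

theorem fracSol_eq {γ μ ν : ℝ} (hγ : γ ≠ 0) (hμ : 0 < μ) (hν : 0 < ν) (hν1 : ν < 1) {x t : ℝ}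
    (hx : 0 < x) (ht : 0 < t) : fracSol γ μ ν x t =
      |γ| / Real.Gamma μ / x * (mellinInv 0 (solKernel μ ν) (x ^ γ / t ^ ν)).re := by
  rw [fracSol, if_neg hν1.ne, (fracSol_aux hγ hμ hν hν1 hx ht).2]

/-! ### The equation for `ν < 1`. -/

theorem gStar_eq {γ μ : ℝ} {f G G' : ℝ → ℝ} {d x : ℝ} (hx : 0 < x)
    (hf : ∀ z, 0 < z → 1 / z ^ (γ * μ - 1) * f z = G z) (hG : ∀ y, 0 < y → HasDerivAt G (G' y) y)
    (hd : HasDerivAt (fun y => y ^ (γ * μ - γ + 1) * G' y) d x) :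
    gStar γ μ f x = 1 / γ ^ 2 * d := by
  have h1 : ∀ y, 0 < y → deriv (fun z => 1 / z ^ (γ * μ - 1) * f z) y = G' y := by
    intro y hy
    refine (hG y hy).congr_of_eventuallyEq ?_ |>.deriv
    filter_upwards [lt_mem_nhds hy] with z hz using hf z hz
  have h2 : (fun y => y ^ (γ * μ - γ + 1) * deriv (fun z => 1 / z ^ (γ * μ - 1) * f z) y) =ᶠ[𝓝 x]
      fun y => y ^ (γ * μ - γ + 1) * G' y := by
    filter_upwards [lt_mem_nhds hx] with y hy
    rw [h1 y hy]
  rw [gStar, h2.deriv_eq, hd.deriv]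

theorem hasDerivAt_rpow_mul_re_mellinInv {A B : ℂ → ℂ} (h : StripDecay A 0 0) {k y : ℝ}
    (hk : 0 < k) (hy : 0 < y) (p q : ℝ)
    (hB : ∀ z : ℂ, z.re = 0 → (p + (-q) * z) * A z = B z) :
    HasDerivAt (fun y : ℝ => y ^ p * (mellinInv 0 A (k * y ^ q)).re)
      (y ^ (p - 1) * (mellinInv 0 B (k * y ^ q)).re) y := by
  have h1 := h.hasDerivAt_rpow_mul_mellinInv hk hy p q
  have h2 := Complex.reCLM.hasFDerivAt.comp_hasDerivAt y h1
  rw [mellinInv_congr hB] at h2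
  simp only [Function.comp_def, Complex.reCLM_apply, Complex.re_ofReal_mul] at h2
  exact h2

/-- Division by the weight leaves the power `x^(-γμ)`, whose derivative contributes `-γ(μ+z)`. The
factor `x^(γμ-γ+1)` then leaves `x^(-γ)`, contributing `-γ(1+z)`; the resulting `γ²` cancels the
prefactor. -/
theorem gStar_fracSol {γ μ ν : ℝ} (hγ : γ ≠ 0) (hμ : 0 < μ) (hν : 0 < ν) (hν1 : ν < 1) {x t : ℝ}
    (hx : 0 < x) (ht : 0 < t) : gStar γ μ (fun y => fracSol γ μ ν y t) x =
      |γ| / Real.Gamma μ * (x ^ (-γ - 1) *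
        (mellinInv 0 (fun z => (1 + z) * ((μ + z) * solKernel μ ν z)) (x ^ γ / t ^ ν)).re) := by
  set A := solKernel μ ν with hA
  have hA0 : StripDecay A 0 0 := stripDecay_solKernel hν hν1 (by norm_num) (by simpa)
  have hA1 : StripDecay (fun z => (μ + z) * A z) 0 0 := by simpa using hA0.affine_mul μ 1
  have hk : 0 < (t ^ ν)⁻¹ := by positivity
  set c := |γ| / Real.Gamma μ with hc
  have hA1' : StripDecay (fun z => -γ * ((μ + z) * A z)) 0 0 := by
    simpa using hA1.affine_mul (-γ) 0
  rw [gStar_eq (d := c * (x ^ (-γ - 1) * (mellinInv 0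
      (fun z => (γ : ℂ) ^ 2 * ((1 + z) * ((μ + z) * A z))) ((t ^ ν)⁻¹ * x ^ γ)).re))
    (G := fun z => c * (z ^ (-(γ * μ)) * (mellinInv 0 A ((t ^ ν)⁻¹ * z ^ γ)).re))
    (G' := fun y => c * (y ^ (-(γ * μ) - 1) * (mellinInv 0
      (fun z => -γ * ((μ + z) * A z)) ((t ^ ν)⁻¹ * y ^ γ)).re)) hx]
  · rw [mellinInv_const_mul, ← Complex.ofReal_pow, Complex.re_ofReal_mul, inv_mul_eq_div]
    field_simp
  · intro z hz
    rw [fracSol_eq hγ hμ hν hν1 hz ht, inv_mul_eq_div, Real.rpow_neg hz.le,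
      Real.rpow_sub_one hz.ne', ← hA, ← hc]
    field_simp
  · intro y hy
    refine (hasDerivAt_rpow_mul_re_mellinInv hA0 hk hy _ _ fun z _ => ?_).const_mul c
    push_cast
    ring
  · have h1 := (hasDerivAt_rpow_mul_re_mellinInv (B := fun z => (γ : ℂ) ^ 2 * ((1 + z) *
      ((μ + z) * A z))) hA1' hk hx (-γ) γ fun z _ => by push_cast; ring).const_mul c
    refine h1.congr_of_eventuallyEq ?_
    filter_upwards [lt_mem_nhds hx] with y hy
    rw [mul_left_comm, ← mul_assoc (y ^ (γ * μ - γ + 1)), ← Real.rpow_add hy]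
    congr 3
    ring

/-- The Mellin transform of the fractional integral of order `1 - ν` of the solution. -/
noncomputable def fracIntKernel (μ ν : ℝ) (z : ℂ) : ℂ :=
  Complex.Gamma ((1 : ℝ) + z) / Complex.Gamma ((2 - ν : ℝ) + ν * z) * Complex.Gamma (μ + z)

/-- Time enters as `s^(νz)`, and the Beta integral of `(r-s)^(-ν) s^(νz)` is `r^(1-ν+νz) Γ(1-ν)
Γ(1+νz) / Γ(2-ν+νz)`; its `Γ(1+νz)` cancels the denominator of `solKernel`. -/
theorem fracInt_fracSol {γ μ ν : ℝ} (hγ : γ ≠ 0) (hμ : 0 < μ) (hν : 0 < ν) (hν1 : ν < 1) {x r : ℝ}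
    (hx : 0 < x) (hr : 0 < r) :
    IntervalIntegrable (fun s => (r - s) ^ (-ν) * fracSol γ μ ν x s) volume 0 r ∧
    1 / Real.Gamma (1 - ν) * ∫ s in (0 : ℝ)..r, (r - s) ^ (-ν) * fracSol γ μ ν x s =
      |γ| / Real.Gamma μ / x *
        (r ^ (1 - ν) * (mellinInv 0 (fracIntKernel μ ν) (x ^ γ * r ^ (-ν))).re) := by
  set A := solKernel μ ν with hA
  have hA0 : StripDecay A 0 0 := stripDecay_solKernel hν hν1 (by norm_num) (by simpa)
  set w := x ^ γ with hw
  have hw0 : 0 < w := by positivity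
  set c := |γ| / Real.Gamma μ / x with hc
  set F : ℝ → ℂ := fun s => (((r - s) ^ (-ν) : ℝ) : ℂ) with hF
  have hFint : Integrable (fun s => F s * (((w / s ^ ν) ^ (-(0 : ℝ)) : ℝ) : ℂ))
      (volume.restrict (Ioc 0 r)) := by
    have h1 := (intervalIntegral.intervalIntegrable_rpow' (a := r) (b := 0) (r := -ν)
      (by linarith)).comp_sub_left r
    simp only [sub_self, sub_zero] at h1
    rw [intervalIntegrable_iff_integrableOn_Ioc_of_le hr.le] at h1
    simpa [hF] using h1.ofReal (𝕜 := ℂ)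
  obtain ⟨h1, h2⟩ := integral_mul_mellinInv (m := volume.restrict (Ioc 0 r))
    (k := fun s : ℝ => w / s ^ ν) (by fun_prop) (by
      filter_upwards [ae_restrict_mem measurableSet_Ioc] with s hs
      have := hs.1
      positivity) hFint (hA0.verticalIntegrable le_rfl le_rfl)
  have hintegrand : ∀ s ∈ Ioc 0 r, (c * (F s * mellinInv 0 A (w / s ^ ν)).re) =
      (r - s) ^ (-ν) * fracSol γ μ ν x s := by
    intro s hs
    rw [fracSol_eq hγ hμ hν hν1 hx hs.1, hF, Complex.re_ofReal_mul]
    ring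
  constructor
  · rw [intervalIntegrable_iff_integrableOn_Ioc_of_le hr.le]
    exact IntegrableOn.congr_fun (h1.re.const_mul c) hintegrand measurableSet_Ioc
  rw [intervalIntegral.integral_of_le hr.le,
    ← setIntegral_congr_fun measurableSet_Ioc hintegrand, integral_const_mul]
  have h3 := Complex.reCLM.integral_comp_comm h1
  simp only [Complex.reCLM_apply] at h3
  rw [h3, h2]
  have hG : Real.Gamma (1 - ν) ≠ 0 := (Real.Gamma_pos_of_pos (by linarith)).ne'
  have hr0 : (r : ℂ) ≠ 0 := by exact_mod_cast hr.ne'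
  have hinner : ∀ y : ℝ, ∫ s in Ioc 0 r, F s * ((w / s ^ ν : ℝ) : ℂ) ^
      (-((0 : ℝ) + y * Complex.I) : ℂ) = ((Real.Gamma (1 - ν) * r ^ (1 - ν) : ℝ) : ℂ) *
        (((w * r ^ (-ν) : ℝ) : ℂ) ^ (-((0 : ℝ) + y * Complex.I) : ℂ) *
          (Complex.Gamma ((1 : ℝ) + ν * (y * Complex.I)) /
            Complex.Gamma ((2 - ν : ℝ) + ν * (y * Complex.I)))) := by
    intro y
    have e1 : ∀ s ∈ Ioc 0 r, F s * ((w / s ^ ν : ℝ) : ℂ) ^ (-((0 : ℝ) + y * Complex.I) : ℂ) =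
        (w : ℂ) ^ (-(y * Complex.I)) * ((s : ℂ) ^ ((1 + ν * (y * Complex.I)) - 1 : ℂ) *
          ((r : ℂ) - s) ^ ((1 - ν) - 1 : ℂ)) := by
      intro s hs
      change (((r - s) ^ (-ν) : ℝ) : ℂ) * _ = _
      rw [ofReal_div_cpow hw0 (Real.rpow_pos_of_pos hs.1 ν), ofReal_rpow_cpow hs.1,
        Complex.ofReal_cpow (sub_nonneg.2 hs.2)]
      push_cast
      ring_nf
    have hs : 0 < (1 + ν * (y * Complex.I) : ℂ).re := by simp
    have ht : 0 < (1 - ν : ℂ).re := by simpa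
    have hbeta := Complex.Gamma_mul_Gamma_eq_betaIntegral hs ht
    have hne : Complex.Gamma ((1 + ν * (y * Complex.I)) + (1 - ν) : ℂ) ≠ 0 :=
      Complex.Gamma_ne_zero_of_re_pos (by rw [Complex.add_re]; linarith)
    have hB := eq_div_of_mul_eq hne ((mul_comm _ _).trans hbeta.symm)
    rw [setIntegral_congr_fun measurableSet_Ioc e1, integral_const_mul,
      ← intervalIntegral.integral_of_le hr.le, Complex.betaIntegral_scaled _ _ hr,
      hB, Real.rpow_neg hr.le,
      ← div_eq_mul_inv, ofReal_div_cpow hw0 (Real.rpow_pos_of_pos hr ν), ofReal_rpow_cpow hr,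
      show (1 + ν * (y * Complex.I) + (1 - ν) - 1 : ℂ) = (1 - ν : ℝ) + ν * (y * Complex.I) by
        push_cast; ring, Complex.cpow_add _ _ hr0, ← Complex.ofReal_cpow hr.le,
      show (1 + ν * (y * Complex.I) + (1 - ν) : ℂ) = (2 - ν : ℝ) + ν * (y * Complex.I) by
        push_cast; ring,
      show (1 - ν : ℂ) = ((1 - ν : ℝ) : ℂ) by push_cast; ring, Complex.Gamma_ofReal]
    simp only [Complex.ofReal_zero, zero_add, neg_neg, Complex.ofReal_one]
    push_cast
    ring
  simp_rw [hinner]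
  have e2 : (1 / (2 * π) : ℝ) • ∫ y : ℝ, A ((0 : ℝ) + y * Complex.I) *
      (((Real.Gamma (1 - ν) * r ^ (1 - ν) : ℝ) : ℂ) *
        (((w * r ^ (-ν) : ℝ) : ℂ) ^ (-((0 : ℝ) + y * Complex.I) : ℂ) *
          (Complex.Gamma ((1 : ℝ) + ν * (y * Complex.I)) /
            Complex.Gamma ((2 - ν : ℝ) + ν * (y * Complex.I))))) =
      ((Real.Gamma (1 - ν) * r ^ (1 - ν) : ℝ) : ℂ) *
        mellinInv 0 (fracIntKernel μ ν) (w * r ^ (-ν)) := by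
    rw [mellinInv, mul_smul_comm, ← integral_const_mul]
    congr 2 with y
    have hne : Complex.Gamma ((1 : ℝ) + ν * (y * Complex.I)) ≠ 0 :=
      Complex.Gamma_ne_zero_of_re_pos (by simp)
    rw [hA, solKernel, fracIntKernel]
    simp only [Complex.ofReal_zero, zero_add, smul_eq_mul]
    generalize Complex.Gamma ((1 : ℝ) + ν * (y * Complex.I)) = G at hne ⊢
    field_simp
  rw [e2, Complex.re_ofReal_mul]
  field_simp

/-- This is the equation on the level of kernels. By `Γ(w+1) = w Γ(w)` the right kernel is `Γ(2+z)
Γ(μ+1+z) / Γ(1+νz)`, and its translate by `z ↦ z - 1` is the left one. The factor `Y` comes from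
that translation, and the double negation from an exponent `-ν` of time. -/
theorem mellinInv_fracIntKernel {μ ν : ℝ} (hμ : 0 < μ) (hν : 0 < ν) (hν1 : ν < 1) {Y : ℝ}
    (hY : 0 < Y) :
    Y * mellinInv 0 (fun z => ((1 - ν : ℝ) + (-(-ν : ℝ)) * z) * fracIntKernel μ ν z) Y =
      mellinInv 0 (fun z => (1 + z) * ((μ + z) * solKernel μ ν z)) Y := by
  set B : ℂ → ℂ := fun z => Complex.Gamma ((2 : ℝ) + z) / Complex.Gamma ((1 : ℝ) + ν * z) *
    Complex.Gamma ((μ + 1 : ℝ) + z) with hB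
  -- The raised arguments `2 + z` and `μ + 1 + z` keep positive real part down to `Re z = -1`, so no
  -- pole is crossed.
  have hBs : StripDecay B (-1) 0 :=
    (stripDecay_Gamma_div_Gamma hν hν1 (by norm_num)).mul_Gamma (by linarith)
  have h1 : mellinInv 0 (fun z => (1 + z) * ((μ + z) * solKernel μ ν z)) Y = mellinInv 0 B Y := by
    refine mellinInv_congr (fun z hz => ?_) Y
    have e1 : (1 : ℂ) + z ≠ 0 := by
      intro h
      have := congrArg Complex.re h
      simp [hz] at this
    have e2 : (μ : ℂ) + z ≠ 0 := by
      intro h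
      have := congrArg Complex.re h
      simp [hz] at this
      exact hμ.ne' this
    rw [hB, solKernel]
    simp only
    rw [show ((2 : ℝ) + z : ℂ) = (1 + z) + 1 by push_cast; ring, Complex.Gamma_add_one _ e1,
      show ((μ + 1 : ℝ) + z : ℂ) = (μ + z) + 1 by push_cast; ring, Complex.Gamma_add_one _ e2,
      Complex.ofReal_one]
    ring
  rw [h1, ← hBs.mellinInv_eq (by norm_num) hY, show (-1 : ℝ) = 0 - 1 by norm_num,
    mellinInv_sub_one _ _ hY]
  congr 1
  refine mellinInv_congr (fun z hz => ?_) Y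
  have e3 : ((1 - ν : ℝ) + ν * z : ℂ) ≠ 0 := by
    intro h
    have := congrArg Complex.re h
    simp [hz] at this
    linarith
  rw [hB, fracIntKernel]
  simp only
  rw [show ((2 - ν : ℝ) + ν * z : ℂ) = ((1 - ν : ℝ) + ν * z) + 1 by push_cast; ring,
    Complex.Gamma_add_one _ e3, show ((2 : ℝ) + (z - 1) : ℂ) = (1 : ℝ) + z by push_cast; ring,
    show ((μ + 1 : ℝ) + (z - 1) : ℂ) = μ + z by push_cast; ring,
    show ((1 : ℝ) + ν * (z - 1) : ℂ) = (1 - ν : ℝ) + ν * z by push_cast; ring, Complex.ofReal_neg,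
    neg_neg]
  field_simp

theorem stripDecay_fracIntKernel {μ ν : ℝ} (hμ : 0 < μ) (hν : 0 < ν) (hν1 : ν < 1) :
    StripDecay (fracIntKernel μ ν) 0 0 :=
  (stripDecay_Gamma_div_Gamma hν hν1 (by norm_num)).mul_Gamma (by simpa)

theorem hasRLDerivAt_fracSol {γ μ ν : ℝ} (hγ : γ ≠ 0) (hμ : 0 < μ) (hν : 0 < ν) (hν1 : ν < 1)
    {x t : ℝ} (hx : 0 < x) (ht : 0 < t) :
    HasRLDerivAt ν (fun r => fracSol γ μ ν x r) (gStar γ μ (fun y => fracSol γ μ ν y t) x) t := by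
  rw [HasRLDerivAt, if_neg hν1.ne]
  refine ⟨fun r hr => (fracInt_fracSol hγ hμ hν hν1 hx hr).1, ?_⟩
  have hw0 : 0 < x ^ γ := by positivity
  have h1 := (hasDerivAt_rpow_mul_re_mellinInv (stripDecay_fracIntKernel hμ hν hν1) hw0 ht (1 - ν)
    (-ν) fun z _ => rfl).const_mul (|γ| / Real.Gamma μ / x)
  have h2 := h1.congr_of_eventuallyEq (f₁ := fun r => 1 / Real.Gamma (1 - ν) *
    ∫ s in (0 : ℝ)..r, (r - s) ^ (-ν) * fracSol γ μ ν x s) (by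
      filter_upwards [lt_mem_nhds ht] with r hr
      exact (fracInt_fracSol hγ hμ hν hν1 hx hr).2)
  refine h2.congr_deriv ?_
  have hY : 0 < x ^ γ / t ^ ν := by positivity
  rw [gStar_fracSol hγ hμ hν hν1 hx ht, ← mellinInv_fracIntKernel hμ hν hν1 hY,
    Complex.re_ofReal_mul, Real.rpow_neg ht.le, ← div_eq_mul_inv, show 1 - ν - 1 = -ν by ring,
    Real.rpow_neg ht.le, Real.rpow_sub_one hx.ne', Real.rpow_neg hx.le]
  field_simp

/-! ### Regularity in space and pointwise vanishing as `t → 0+`. -/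

theorem contDiffOn_fracSol {γ μ ν : ℝ} (hγ : γ ≠ 0) (hμ : 0 < μ) (hν : 0 < ν) (hν1 : ν < 1)
    {t : ℝ} (ht : 0 < t) (n : ℕ) : ContDiffOn ℝ n (fun x => fracSol γ μ ν x t) (Ioi 0) := by
  have hA0 : StripDecay (solKernel μ ν) 0 0 :=
    stripDecay_solKernel hν hν1 (by norm_num) (by simpa)
  have h1 : ContDiffOn ℝ n (fun x : ℝ => x ^ γ / t ^ ν) (Ioi 0) :=
    ContDiffOn.div_const (fun x hx =>
      (Real.contDiffAt_rpow_const_of_ne (ne_of_gt hx)).contDiffWithinAt) _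
  have h2 : ContDiffOn ℝ n (fun x : ℝ => mellinInv 0 (solKernel μ ν) (x ^ γ / t ^ ν)) (Ioi 0) :=
    (hA0.contDiffOn_mellinInv n).comp h1 fun x hx => by
      have : 0 < x := hx
      change 0 < x ^ γ / t ^ ν
      positivity
  have h3 : ContDiffOn ℝ n (fun x : ℝ => |γ| / Real.Gamma μ / x) (Ioi 0) :=
    contDiffOn_const.div contDiffOn_id fun x hx => ne_of_gt hx
  refine (h3.mul (Complex.reCLM.contDiff.comp_contDiffOn h2)).congr fun x hx => ?_
  exact fracSol_eq hγ hμ hν hν1 hx ht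

/-- Moving the contour from `Re z = 0` to `Re z = 1` gives the bound `(x^γ / t^ν)^(-1)`, which is
`O(t^ν)`. -/
theorem tendsto_fracSol_zero {γ μ ν : ℝ} (hγ : γ ≠ 0) (hμ : 0 < μ) (hν : 0 < ν) (hν1 : ν < 1)
    {x : ℝ} (hx : 0 < x) : Tendsto (fun t => fracSol γ μ ν x t) (𝓝[>] 0) (𝓝 0) := by
  have hA : StripDecay (solKernel μ ν) 0 1 :=
    stripDecay_solKernel hν hν1 (by norm_num) (by simpa)
  obtain ⟨C, hC0, hC⟩ := norm_mellinInv_le 1 (solKernel μ ν)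
  have hb : Tendsto (fun t : ℝ => |γ| / Real.Gamma μ / x * (C * (x ^ γ / t ^ ν) ^ (-(1 : ℝ))))
      (𝓝[>] 0) (𝓝 0) := by
    have h1 : Tendsto (fun t : ℝ => t ^ ν) (𝓝[>] 0) (𝓝 0) := by
      have := (Real.continuousAt_rpow_const 0 ν (Or.inr hν.le)).tendsto
      rw [Real.zero_rpow hν.ne'] at this
      exact this.mono_left nhdsWithin_le_nhds
    have h2 := ((h1.div_const (x ^ γ)).const_mul C).const_mul (|γ| / Real.Gamma μ / x)
    simpa [Real.rpow_neg_one] using h2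
  refine squeeze_zero_norm' ?_ hb
  filter_upwards [self_mem_nhdsWithin] with t ht
  have ht' : 0 < t := ht
  have hY : 0 < x ^ γ / t ^ ν := by positivity
  have hG := Real.Gamma_pos_of_pos hμ
  rw [fracSol_eq hγ hμ hν hν1 hx ht, norm_mul, Real.norm_of_nonneg (by positivity),
    hA.mellinInv_eq zero_le_one hY]
  gcongr
  exact (Complex.abs_re_le_norm _).trans (hC _ hY)

/-! ### Mass and concentration of the generalized gamma density. -/

theorem genGammaTilde_nonneg {γ : ℝ} (hγ : γ ≠ 0) {μ : ℝ} (hμ : 0 < μ) {x t : ℝ} (hx : 0 < x)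
    (ht : 0 < t) : 0 ≤ genGammaTilde γ μ x t := by
  have := Real.Gamma_pos_of_pos hμ
  rw [genGammaTilde_eq hγ μ hx ht]
  positivity

/-- The form required by the substitution `w = x^γ`, which turns the density into a Gamma density of
scale `t`. -/
theorem genGammaTilde_eq_mul_comp_rpow {γ : ℝ} (hγ : γ ≠ 0) (μ : ℝ) {x t : ℝ} (hx : 0 < x)
    (ht : 0 < t) : genGammaTilde γ μ x t = (|γ| * x ^ (γ - 1)) •
      (t ^ (-μ) / Real.Gamma μ * ((x ^ γ) ^ (μ - 1) * rexp (-(t⁻¹ * x ^ γ)))) := by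
  rw [genGammaTilde_eq hγ μ hx ht, ← Real.rpow_mul hx.le,
    show γ * μ - 1 = (γ - 1) + γ * (μ - 1) by ring, Real.rpow_add hx, smul_eq_mul,
    inv_mul_eq_div]
  ring

theorem integrableOn_genGammaTilde {γ : ℝ} (hγ : γ ≠ 0) {μ : ℝ} (hμ : 0 < μ) {t : ℝ}
    (ht : 0 < t) : IntegrableOn (fun x => genGammaTilde γ μ x t) (Ioi 0) := by
  have h1 := (integrableOn_rpow_mul_exp_neg_mul hμ (inv_pos.2 ht)).const_mul
    (t ^ (-μ) / Real.Gamma μ)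
  have h2 := (integrableOn_Ioi_comp_rpow_iff _ hγ).2 h1
  exact h2.congr_fun (fun x hx => (genGammaTilde_eq_mul_comp_rpow hγ μ hx ht).symm)
    measurableSet_Ioi

/-- All dependence on `t` moves into the test function, so that limits follow by dominated
convergence against a fixed density. -/
theorem integral_mul_genGammaTilde {γ : ℝ} (hγ : γ ≠ 0) (μ : ℝ) {t : ℝ} (ht : 0 < t)
    (φ : ℝ → ℝ) : ∫ x in Ioi (0 : ℝ), φ x * genGammaTilde γ μ x t =
      ∫ v in Ioi (0 : ℝ), φ ((t * v) ^ (1 / γ)) * (v ^ (μ - 1) * rexp (-(1 * v)) / Real.Gamma μ) := by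
  set g : ℝ → ℝ := fun w => φ (w ^ (1 / γ)) *
    (t ^ (-μ) / Real.Gamma μ * (w ^ (μ - 1) * rexp (-(t⁻¹ * w)))) with hg
  have h1 : ∫ x in Ioi (0 : ℝ), φ x * genGammaTilde γ μ x t = ∫ w in Ioi (0 : ℝ), g w := by
    rw [← integral_comp_rpow_Ioi g hγ]
    refine setIntegral_congr_fun measurableSet_Ioi fun x hx => ?_
    have hx' : 0 < x := hx
    have h3 : (x ^ γ) ^ (1 / γ) = x := by
      rw [← Real.rpow_mul hx'.le, mul_one_div_cancel hγ, Real.rpow_one]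
    simp only [hg, h3, genGammaTilde_eq_mul_comp_rpow hγ μ hx' ht, smul_eq_mul]
    ring
  have h2 := integral_comp_mul_left_Ioi g 0 ht
  rw [mul_zero, smul_eq_mul, eq_inv_mul_iff_mul_eq₀ ht.ne'] at h2
  rw [h1, ← h2, ← integral_const_mul]
  refine setIntegral_congr_fun measurableSet_Ioi fun v hv => ?_
  have hv' : 0 < v := hv
  have h4 : t * (t ^ (-μ) * t ^ (μ - 1)) = 1 := by
    rw [← Real.rpow_add ht, show -μ + (μ - 1) = -1 by ring, Real.rpow_neg_one,
      mul_inv_cancel₀ ht.ne']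
  simp only [hg]
  rw [Real.mul_rpow (z := μ - 1) ht.le hv'.le, inv_mul_cancel_left₀ ht.ne', one_mul]
  linear_combination (φ ((t * v) ^ (1 / γ)) * v ^ (μ - 1) * rexp (-v) / Real.Gamma μ) * h4

theorem integral_genGammaTilde {γ : ℝ} (hγ : γ ≠ 0) {μ : ℝ} (hμ : 0 < μ) {t : ℝ}
    (ht : 0 < t) : ∫ x in Ioi (0 : ℝ), genGammaTilde γ μ x t = 1 := by
  have h := integral_mul_genGammaTilde hγ μ ht fun _ => 1
  simp only [one_mul] at h
  have h2 := Real.integral_rpow_mul_exp_neg_mul_Ioi hμ one_pos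
  simp only [one_mul, one_div_one, Real.one_rpow] at h2
  rw [h, integral_div, h2, div_self (Real.Gamma_pos_of_pos hμ).ne']

theorem abs_integral_mul_genGammaTilde_le {γ : ℝ} (hγ : γ ≠ 0) {μ : ℝ} (hμ : 0 < μ) {t : ℝ}
    (ht : 0 < t) {φ : ℝ → ℝ} {C : ℝ} (hφ : ∀ x, |φ x| ≤ C) :
    |∫ x in Ioi (0 : ℝ), φ x * genGammaTilde γ μ x t| ≤ C := by
  have h : ∫ x in Ioi (0 : ℝ), C * genGammaTilde γ μ x t = C := by
    rw [integral_const_mul, integral_genGammaTilde hγ hμ ht, mul_one]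
  rw [← Real.norm_eq_abs]
  refine (norm_integral_le_of_norm_le ((integrableOn_genGammaTilde hγ hμ ht).const_mul C)
    ?_).trans h.le
  filter_upwards [ae_restrict_mem measurableSet_Ioi] with x hx
  rw [norm_mul, Real.norm_of_nonneg (genGammaTilde_nonneg hγ hμ hx ht)]
  exact mul_le_mul_of_nonneg_right (hφ x) (genGammaTilde_nonneg hγ hμ hx ht)

theorem tendsto_mul_right_nhdsGT_zero {v : ℝ} (hv : 0 < v) :
    Tendsto (fun t : ℝ => t * v) (𝓝[>] 0) (𝓝[>] 0) := by
  refine tendsto_nhdsWithin_iff.2 ⟨?_, ?_⟩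
  · have : Tendsto (fun t : ℝ => t * v) (𝓝 0) (𝓝 (0 * v)) :=
      (continuous_id.mul continuous_const).tendsto 0
    rw [zero_mul] at this
    exact this.mono_left nhdsWithin_le_nhds
  · filter_upwards [self_mem_nhdsWithin] with t ht
    exact mul_pos ht hv

/-- Stating the limit of `φ` along `s^(1/γ)` covers both endpoints: this power tends to 0 for `γ >
0` and to infinity for `γ < 0`. -/
theorem tendsto_integral_mul_genGammaTilde {γ : ℝ} (hγ : γ ≠ 0) {μ : ℝ} (hμ : 0 < μ)
    {φ : ℝ → ℝ} (hφc : Continuous φ) {C L : ℝ} (hφ : ∀ x, |φ x| ≤ C)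
    (hL : Tendsto (fun s : ℝ => φ (s ^ (1 / γ))) (𝓝[>] 0) (𝓝 L)) :
    Tendsto (fun t => ∫ x in Ioi (0 : ℝ), φ x * genGammaTilde γ μ x t) (𝓝[>] 0) (𝓝 L) := by
  have hi : IntegrableOn (fun v : ℝ => v ^ (μ - 1) * rexp (-(1 * v)) / Real.Gamma μ) (Ioi 0) :=
    (integrableOn_rpow_mul_exp_neg_mul hμ one_pos).div_const _
  have hmass : ∫ v in Ioi (0 : ℝ), v ^ (μ - 1) * rexp (-(1 * v)) / Real.Gamma μ = 1 := by
    have h := integral_mul_genGammaTilde hγ μ one_pos fun _ => 1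
    simp only [one_mul] at h
    simpa [integral_genGammaTilde hγ hμ one_pos] using h.symm
  have key : Tendsto (fun t => ∫ v in Ioi (0 : ℝ), φ ((t * v) ^ (1 / γ)) *
      (v ^ (μ - 1) * rexp (-(1 * v)) / Real.Gamma μ)) (𝓝[>] 0)
      (𝓝 (∫ v in Ioi (0 : ℝ), L * (v ^ (μ - 1) * rexp (-(1 * v)) / Real.Gamma μ))) := by
    refine tendsto_integral_filter_of_dominated_convergence
      (fun v => C * ‖v ^ (μ - 1) * rexp (-(1 * v)) / Real.Gamma μ‖) ?_ ?_ (hi.norm.const_mul C) ?_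
    · refine Eventually.of_forall fun t => ?_
      have hm : Measurable fun v : ℝ => φ ((t * v) ^ (1 / γ)) :=
        hφc.measurable.comp (by fun_prop)
      exact hm.aestronglyMeasurable.mul hi.aestronglyMeasurable
    · refine Eventually.of_forall fun t => Eventually.of_forall fun v => ?_
      rw [norm_mul]
      exact mul_le_mul_of_nonneg_right (hφ _) (norm_nonneg _)
    · filter_upwards [ae_restrict_mem measurableSet_Ioi] with v hv
      exact (hL.comp (tendsto_mul_right_nhdsGT_zero hv)).mul_const _
  rw [integral_const_mul, hmass, mul_one] at key
  refine key.congr' ?_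
  filter_upwards [self_mem_nhdsWithin] with t ht
  exact (integral_mul_genGammaTilde hγ μ ht φ).symm

/-! ### Subordination: mass and weak limit for `ν < 1`. -/

/-- The `M`-Wright function, the density of the inverse `ν`-stable subordinator at time one. -/
noncomputable def mWright (ν σ : ℝ) : ℝ := (mellinInv 1 (invStableKernel ν) σ).re

theorem invStableDensity_eq (ν s t : ℝ) :
    invStableDensity ν s t = 1 / t ^ ν * mWright ν (s / t ^ ν) := rfl

theorem integrableOn_mWright {ν : ℝ} (hν : 0 < ν) (hν1 : ν < 1) :
    IntegrableOn (mWright ν) (Ioi 0) :=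
  ((stripDecay_invStableKernel hν hν1 one_half_pos).integrableOn_mellinInv (b := 2)
    (by norm_num) (by norm_num) (by norm_num) (by norm_num)).re

/-- The integral is a Mellin transform at 1, so inversion gives the kernel value `Γ(1) / Γ(1) = 1`.
-/
theorem integral_mWright {ν : ℝ} (hν : 0 < ν) (hν1 : ν < 1) :
    ∫ σ in Ioi (0 : ℝ), mWright ν σ = 1 := by
  have hK : StripDecay (invStableKernel ν) (1 / 2) 2 :=
    stripDecay_invStableKernel hν hν1 one_half_pos
  have hi := hK.integrableOn_mellinInv (c := 1) (by norm_num) (by norm_num) (by norm_num)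
    (by norm_num)
  have h1 := hK.mellin_mellinInv (c := 1) (by norm_num) (by norm_num)
  rw [invStableKernel_eq] at h1
  simp only [mellin, Complex.ofReal_one, sub_self, Complex.cpow_zero, one_smul, mul_one,
    sub_add_cancel, Complex.Gamma_one, div_one] at h1
  have h2 := Complex.reCLM.integral_comp_comm hi
  simp only [Complex.reCLM_apply] at h2
  simp only [mWright]
  rw [h2, h1, Complex.one_re]

theorem integrableOn_invStableDensity {ν : ℝ} (hν : 0 < ν) (hν1 : ν < 1) {t : ℝ} (ht : 0 < t) :
    IntegrableOn (fun s => invStableDensity ν s t) (Ioi 0) := by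
  have hτ : 0 < (t ^ ν)⁻¹ := by positivity
  have h := (integrableOn_Ioi_comp_mul_left_iff (mWright ν) 0 hτ).2 (by
    rw [mul_zero]
    exact integrableOn_mWright hν hν1)
  refine IntegrableOn.congr_fun (h.const_mul (1 / t ^ ν)) (fun s _ => ?_) measurableSet_Ioi
  rw [invStableDensity_eq]
  change _ * mWright ν ((t ^ ν)⁻¹ * s) = _
  rw [inv_mul_eq_div]

/-- Integrating the modulus in `x` first leaves `|l_ν|`, because `g̃` is nonnegative with mass one.
Integrability of `l_ν` is enough; its sign plays no role. -/
theorem integrable_prod_genGammaTilde_invStableDensity {γ μ ν : ℝ} (hγ : γ ≠ 0) (hμ : 0 < μ)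
    (hν : 0 < ν) (hν1 : ν < 1) {t : ℝ} (ht : 0 < t) :
    Integrable (fun p : ℝ × ℝ => genGammaTilde γ μ p.2 p.1 * invStableDensity ν p.1 t)
      ((volume.restrict (Ioi 0)).prod (volume.restrict (Ioi 0))) := by
  have hl := integrableOn_invStableDensity hν hν1 ht
  have hm : Measurable fun p : ℝ × ℝ => genGammaTilde γ μ p.2 p.1 := by
    unfold genGammaTilde genGamma genGammaQ
    fun_prop
  refine (integrable_prod_iff (hm.aestronglyMeasurable.mul
    (hl.aestronglyMeasurable.comp_fst (ν := volume.restrict (Ioi 0))))).2 ⟨?_, ?_⟩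
  · filter_upwards [ae_restrict_mem measurableSet_Ioi] with s hs
    exact Integrable.mul_const (integrableOn_genGammaTilde hγ hμ hs) (invStableDensity ν s t)
  · refine hl.norm.congr ?_
    filter_upwards [ae_restrict_mem measurableSet_Ioi] with s hs
    have h1 : ∀ x ∈ Ioi (0 : ℝ), ‖genGammaTilde γ μ x s * invStableDensity ν s t‖ =
        genGammaTilde γ μ x s * ‖invStableDensity ν s t‖ := by
      intro x hx
      rw [norm_mul, Real.norm_of_nonneg (genGammaTilde_nonneg hγ hμ hx hs)]
    simp only [Pi.mul_apply]
    rw [setIntegral_congr_fun measurableSet_Ioi h1, integral_mul_const,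
      integral_genGammaTilde hγ hμ hs, one_mul]

/-- Fubini followed by `s = t^ν σ`. The weight `mWright` no longer depends on `t`, so `C |mWright|`
dominates in the limit `t → 0+`. -/
theorem integral_mul_fracSol {γ μ ν : ℝ} (hγ : γ ≠ 0) (hμ : 0 < μ) (hν : 0 < ν) (hν1 : ν < 1)
    {t : ℝ} (ht : 0 < t) {φ : ℝ → ℝ} (hφc : Continuous φ) {C : ℝ} (hφ : ∀ x, |φ x| ≤ C) :
    IntegrableOn (fun x => φ x * fracSol γ μ ν x t) (Ioi 0) ∧
    IntegrableOn (fun σ => mWright ν σ *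
      ∫ x in Ioi (0 : ℝ), φ x * genGammaTilde γ μ x (t ^ ν * σ)) (Ioi 0) ∧
    ∫ x in Ioi (0 : ℝ), φ x * fracSol γ μ ν x t = ∫ σ in Ioi (0 : ℝ), mWright ν σ *
      ∫ x in Ioi (0 : ℝ), φ x * genGammaTilde γ μ x (t ^ ν * σ) := by
  have hτ : 0 < t ^ ν := by positivity
  have hprod : Integrable (fun p : ℝ × ℝ => φ p.2 *
      (genGammaTilde γ μ p.2 p.1 * invStableDensity ν p.1 t))
      ((volume.restrict (Ioi 0)).prod (volume.restrict (Ioi 0))) :=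
    (integrable_prod_genGammaTilde_invStableDensity hγ hμ hν hν1 ht).bdd_mul (c := C)
      (hφc.comp continuous_snd).aestronglyMeasurable (Eventually.of_forall fun p => hφ _)
  have e1 : ∀ x, φ x * fracSol γ μ ν x t = ∫ s in Ioi (0 : ℝ), φ x *
      (genGammaTilde γ μ x s * invStableDensity ν s t) := by
    intro x
    rw [fracSol, if_neg hν1.ne, integral_const_mul]
  have e2 : ∀ s, ∫ x in Ioi (0 : ℝ), φ x * (genGammaTilde γ μ x s * invStableDensity ν s t) =
      (∫ x in Ioi (0 : ℝ), φ x * genGammaTilde γ μ x s) * invStableDensity ν s t := by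
    intro s
    rw [← integral_mul_const]
    congr 1 with x
    ring
  set g : ℝ → ℝ := fun s => (∫ x in Ioi (0 : ℝ), φ x * genGammaTilde γ μ x s) *
    invStableDensity ν s t with hg
  have hgi : IntegrableOn g (Ioi 0) := by
    have := hprod.integral_prod_left
    simp only [e2] at this
    exact this
  have e3 : ∀ σ, mWright ν σ * ∫ x in Ioi (0 : ℝ), φ x * genGammaTilde γ μ x (t ^ ν * σ) =
      t ^ ν * g (t ^ ν * σ) := by
    intro σ
    simp only [hg, invStableDensity_eq]
    rw [mul_div_cancel_left₀ _ hτ.ne']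
    field_simp
  simp_rw [e1, e3]
  refine ⟨hprod.integral_prod_right, ?_, ?_⟩
  · refine Integrable.const_mul ((integrableOn_Ioi_comp_mul_left_iff g 0 hτ).2 ?_) _
    rwa [mul_zero]
  · rw [integral_const_mul, integral_comp_mul_left_Ioi g 0 hτ, mul_zero, smul_eq_mul,
      mul_inv_cancel_left₀ hτ.ne', ← integral_integral_swap hprod]
    simp_rw [e2]
    rfl

theorem integrableOn_fracSol_and_integral_eq_one {γ μ ν : ℝ} (hγ : γ ≠ 0) (hμ : 0 < μ)
    (hν : 0 < ν) (hν1 : ν < 1) {t : ℝ} (ht : 0 < t) :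
    IntegrableOn (fun x => fracSol γ μ ν x t) (Ioi 0) ∧
      ∫ x in Ioi (0 : ℝ), fracSol γ μ ν x t = 1 := by
  obtain ⟨h1, -, h3⟩ := integral_mul_fracSol hγ hμ hν hν1 ht (φ := fun _ => 1) continuous_const
    (C := 1) (by simp)
  simp only [one_mul] at h1 h3
  refine ⟨h1, h3.trans ?_⟩
  rw [← integral_mWright hν hν1]
  refine setIntegral_congr_fun measurableSet_Ioi fun σ hσ => ?_
  have hσ' : 0 < σ := hσ
  rw [integral_genGammaTilde hγ hμ (by positivity), mul_one]

theorem tendsto_integral_mul_fracSol {γ μ ν : ℝ} (hγ : γ ≠ 0) (hμ : 0 < μ) (hν : 0 < ν)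
    (hν1 : ν < 1) {φ : ℝ → ℝ} (hφc : Continuous φ) {C L : ℝ} (hφ : ∀ x, |φ x| ≤ C)
    (hL : Tendsto (fun s : ℝ => φ (s ^ (1 / γ))) (𝓝[>] 0) (𝓝 L)) :
    Tendsto (fun t => ∫ x in Ioi (0 : ℝ), φ x * fracSol γ μ ν x t) (𝓝[>] 0) (𝓝 L) := by
  have hpow : Tendsto (fun t : ℝ => t ^ ν) (𝓝[>] 0) (𝓝[>] 0) := by
    refine tendsto_nhdsWithin_iff.2 ⟨?_, ?_⟩
    · have := (Real.continuousAt_rpow_const 0 ν (Or.inr hν.le)).tendsto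
      rw [Real.zero_rpow hν.ne'] at this
      exact this.mono_left nhdsWithin_le_nhds
    · filter_upwards [self_mem_nhdsWithin] with t ht
      exact Real.rpow_pos_of_pos ht ν
  have hP := tendsto_integral_mul_genGammaTilde hγ hμ hφc hφ hL
  have key : Tendsto (fun t => ∫ σ in Ioi (0 : ℝ), mWright ν σ *
      ∫ x in Ioi (0 : ℝ), φ x * genGammaTilde γ μ x (t ^ ν * σ)) (𝓝[>] 0)
      (𝓝 (∫ σ in Ioi (0 : ℝ), mWright ν σ * L)) := by
    refine tendsto_integral_filter_of_dominated_convergence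
      (fun σ => ‖mWright ν σ‖ * C) ?_ ?_ ((integrableOn_mWright hν hν1).norm.mul_const C) ?_
    · filter_upwards [self_mem_nhdsWithin] with t ht
      exact (integral_mul_fracSol hγ hμ hν hν1 ht hφc hφ).2.1.aestronglyMeasurable
    · filter_upwards [self_mem_nhdsWithin] with t ht
      have ht' : 0 < t := ht
      filter_upwards [ae_restrict_mem measurableSet_Ioi] with σ hσ
      have hσ' : 0 < σ := hσ
      rw [norm_mul]
      exact mul_le_mul_of_nonneg_left
        (abs_integral_mul_genGammaTilde_le hγ hμ (by positivity) hφ) (norm_nonneg _)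
    · filter_upwards [ae_restrict_mem measurableSet_Ioi] with σ hσ
      exact (hP.comp ((tendsto_mul_right_nhdsGT_zero hσ).comp hpow)).const_mul _
  rw [integral_mul_const, integral_mWright hν hν1, one_mul] at key
  refine key.congr' ?_
  filter_upwards [self_mem_nhdsWithin] with t ht
  exact (integral_mul_fracSol hγ hμ hν hν1 ht hφc hφ).2.2.symm

/-! ### The case `ν = 1`, and the conclusion. -/

theorem hasDerivAt_genGammaTilde {γ : ℝ} (hγ : γ ≠ 0) (μ : ℝ) {x t : ℝ} (hx : 0 < x)
    (ht : 0 < t) : HasDerivAt (fun r => genGammaTilde γ μ x r)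
      (gStar γ μ (fun y => genGammaTilde γ μ y t) x) t := by
  set c := |γ| / Real.Gamma μ with hc
  have hexp : ∀ y, 0 < y → HasDerivAt (fun y : ℝ => rexp (-(y ^ γ / t)))
      (rexp (-(y ^ γ / t)) * (-(γ * y ^ (γ - 1) / t))) y := fun y hy =>
    (((Real.hasDerivAt_rpow_const (Or.inl hy.ne')).div_const t).fun_neg).exp
  have hg : gStar γ μ (fun y => genGammaTilde γ μ y t) x = 1 / γ ^ 2 *
      (-(c * t ^ (-μ) * γ / t) * ((γ * μ) * x ^ (γ * μ - 1) * rexp (-(x ^ γ / t)) +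
        x ^ (γ * μ) * (rexp (-(x ^ γ / t)) * (-(γ * x ^ (γ - 1) / t))))) := by
    -- Division by the weight leaves only the exponential; after one derivative the powers combine
    -- to `y^(γμ)`.
    refine gStar_eq (G := fun z => c * t ^ (-μ) * rexp (-(z ^ γ / t)))
      (G' := fun y => c * t ^ (-μ) * (rexp (-(y ^ γ / t)) * (-(γ * y ^ (γ - 1) / t)))) hx ?_ ?_ ?_
    · intro z hz
      rw [genGammaTilde_eq hγ μ hz ht, ← hc]
      have : z ^ (γ * μ - 1) ≠ 0 := by positivity
      field_simp
    · exact fun y hy => (hexp y hy).const_mul _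
    · have h1 := ((Real.hasDerivAt_rpow_const (p := γ * μ) (Or.inl hx.ne')).mul
        (hexp x hx)).const_mul (-(c * t ^ (-μ) * γ / t))
      refine h1.congr_of_eventuallyEq ?_
      filter_upwards [lt_mem_nhds hx] with y hy
      simp only [Pi.mul_apply]
      have h2 : y ^ (γ * μ) = y ^ (γ * μ - γ + 1) * y ^ (γ - 1) := by
        rw [← Real.rpow_add hy]
        ring_nf
      rw [h2]
      ring
  have hd : HasDerivAt (fun r : ℝ => c * x ^ (γ * μ - 1) * (r ^ (-μ) * rexp (-(x ^ γ / r))))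
      (c * x ^ (γ * μ - 1) * (-μ * t ^ (-μ - 1) * rexp (-(x ^ γ / t)) +
        t ^ (-μ) * (rexp (-(x ^ γ / t)) * (x ^ γ / t ^ 2)))) t := by
    have h2 : HasDerivAt (fun r : ℝ => -(x ^ γ / r)) (x ^ γ / t ^ 2) t := by
      have := ((hasDerivAt_inv ht.ne').const_mul (x ^ γ)).fun_neg
      simp only [← div_eq_mul_inv] at this
      exact this.congr_deriv (by ring)
    exact ((Real.hasDerivAt_rpow_const (Or.inl ht.ne')).mul h2.exp).const_mul _
  refine (hd.congr_of_eventuallyEq ?_).congr_deriv ?_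
  · filter_upwards [lt_mem_nhds ht] with r hr
    exact genGammaTilde_eq hγ μ hx hr
  · rw [hg, Real.rpow_sub_one ht.ne', Real.rpow_sub_one hx.ne', Real.rpow_sub_one hx.ne']
    field_simp
    ring

theorem contDiffOn_genGammaTilde {γ : ℝ} (hγ : γ ≠ 0) (μ : ℝ) {t : ℝ} (ht : 0 < t)
    {n : WithTop ℕ∞} : ContDiffOn ℝ n (fun x => genGammaTilde γ μ x t) (Ioi 0) := by
  have hp : ∀ p : ℝ, ContDiffOn ℝ n (fun x : ℝ => x ^ p) (Ioi 0) := fun p x hx =>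
    (Real.contDiffAt_rpow_const_of_ne (ne_of_gt hx)).contDiffWithinAt
  refine ContDiffOn.congr ?_ fun x hx => genGammaTilde_eq hγ μ hx ht
  exact (contDiffOn_const.mul (hp _)).mul (contDiffOn_const.mul ((hp γ).div_const t).neg.exp)

theorem tendsto_genGammaTilde_zero {γ : ℝ} (hγ : γ ≠ 0) (μ : ℝ) {x : ℝ} (hx : 0 < x) :
    Tendsto (fun t => genGammaTilde γ μ x t) (𝓝[>] 0) (𝓝 0) := by
  have hw : 0 < x ^ γ := by positivity
  have h := ((tendsto_rpow_mul_exp_neg_mul_atTop_nhds_zero μ (x ^ γ) hw).comp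
    tendsto_inv_nhdsGT_zero).const_mul (|γ| / Real.Gamma μ * x ^ (γ * μ - 1))
  rw [mul_zero] at h
  refine h.congr' ?_
  filter_upwards [self_mem_nhdsWithin] with t ht
  have ht' : 0 < t := ht
  rw [genGammaTilde_eq hγ μ hx ht', Function.comp_apply, Real.inv_rpow ht'.le,
    ← Real.rpow_neg ht'.le, neg_mul, ← div_eq_mul_inv]

theorem fracSol_one (γ μ x t : ℝ) : fracSol γ μ 1 x t = genGammaTilde γ μ x t := if_pos rfl

theorem tendsto_comp_rpow_of_pos {γ : ℝ} (hγ : 0 < γ) {φ : ℝ → ℝ} (hφ : Continuous φ) :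
    Tendsto (fun s : ℝ => φ (s ^ (1 / γ))) (𝓝[>] 0) (𝓝 (φ 0)) := by
  have h1 : 0 < 1 / γ := by positivity
  have h := (Real.continuousAt_rpow_const 0 (1 / γ) (Or.inr h1.le)).tendsto
  rw [Real.zero_rpow h1.ne'] at h
  exact (hφ.tendsto 0).comp (h.mono_left nhdsWithin_le_nhds)

theorem tendsto_comp_rpow_of_neg {γ : ℝ} (hγ : γ < 0) {φ : ℝ → ℝ} {L : ℝ}
    (hφ : Tendsto φ atTop (𝓝 L)) :
    Tendsto (fun s : ℝ => φ (s ^ (1 / γ))) (𝓝[>] 0) (𝓝 L) := by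
  have h1 : 0 < -(1 / γ) := by
    rw [neg_pos]
    exact one_div_neg.2 hγ
  refine hφ.comp (((tendsto_rpow_atTop h1).comp tendsto_inv_nhdsGT_zero).congr' ?_)
  filter_upwards [self_mem_nhdsWithin] with s hs
  have hs' : 0 < s := hs
  rw [Function.comp_apply, Real.inv_rpow hs'.le, Real.rpow_neg hs'.le, inv_inv]

theorem theorem1 (γ μ ν : ℝ) (hγ : γ ≠ 0) (hμ : 0 < μ) (hν : 0 < ν) (hν1 : ν ≤ 1) :
    -- the integrals that define the solution converge absolutely
    (ν < 1 → Complex.VerticalIntegrable (invStableKernel ν) 1 ∧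
      ∀ x > 0, ∀ t > 0,
        IntegrableOn (fun s => genGammaTilde γ μ x s * invStableDensity ν s t) (Ioi 0)) ∧
    -- regularity in space, and the equation
    (∀ t > 0, ContDiffOn ℝ 2 (fun x => fracSol γ μ ν x t) (Ioi 0)) ∧
    (∀ x > 0, ∀ t > 0,
      HasRLDerivAt ν (fun r => fracSol γ μ ν x r) (gStar γ μ (fun y => fracSol γ μ ν y t) x) t) ∧
    -- initial data: unit mass for all times, vanishing at every point of the open half-line
    (∀ t > 0, IntegrableOn (fun x => fracSol γ μ ν x t) (Ioi 0) ∧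
      ∫ x in Ioi (0 : ℝ), fracSol γ μ ν x t = 1) ∧
    (∀ x > 0, Tendsto (fun t => fracSol γ μ ν x t) (𝓝[>] 0) (𝓝 0)) ∧
    -- initial data: convergence to the unit mass at the endpoint where `x ^ γ` vanishes
    (0 < γ → ∀ φ : ℝ → ℝ, Continuous φ → (∃ C, ∀ x, |φ x| ≤ C) →
      Tendsto (fun t => ∫ x in Ioi (0 : ℝ), φ x * fracSol γ μ ν x t) (𝓝[>] 0) (𝓝 (φ 0))) ∧
    (γ < 0 → ∀ (φ : ℝ → ℝ) (L : ℝ), Continuous φ → (∃ C, ∀ x, |φ x| ≤ C) →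
      Tendsto φ atTop (𝓝 L) →
      Tendsto (fun t => ∫ x in Ioi (0 : ℝ), φ x * fracSol γ μ ν x t) (𝓝[>] 0) (𝓝 L)) := by
  have hweak : ∀ (φ : ℝ → ℝ) (L : ℝ), Continuous φ → (∃ C, ∀ x, |φ x| ≤ C) →
      Tendsto (fun s : ℝ => φ (s ^ (1 / γ))) (𝓝[>] 0) (𝓝 L) →
      Tendsto (fun t => ∫ x in Ioi (0 : ℝ), φ x * fracSol γ μ ν x t) (𝓝[>] 0) (𝓝 L) := by
    rintro φ L hφc ⟨C, hC⟩ hL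
    rcases hν1.lt_or_eq with h | rfl
    · exact tendsto_integral_mul_fracSol hγ hμ hν h hφc hC hL
    · simp_rw [fracSol_one]
      exact tendsto_integral_mul_genGammaTilde hγ hμ hφc hC hL
  have hpos : 0 < γ → ∀ φ : ℝ → ℝ, Continuous φ → (∃ C, ∀ x, |φ x| ≤ C) →
      Tendsto (fun t => ∫ x in Ioi (0 : ℝ), φ x * fracSol γ μ ν x t) (𝓝[>] 0) (𝓝 (φ 0)) :=
    fun h φ hφc hφ => hweak φ _ hφc hφ (tendsto_comp_rpow_of_pos h hφc)
  have hneg : γ < 0 → ∀ (φ : ℝ → ℝ) (L : ℝ), Continuous φ → (∃ C, ∀ x, |φ x| ≤ C) →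
      Tendsto φ atTop (𝓝 L) →
      Tendsto (fun t => ∫ x in Ioi (0 : ℝ), φ x * fracSol γ μ ν x t) (𝓝[>] 0) (𝓝 L) :=
    fun h φ L hφc hφ hL => hweak φ L hφc hφ (tendsto_comp_rpow_of_neg h hL)
  rcases hν1.lt_or_eq with h | rfl
  · exact ⟨fun _ => ⟨(stripDecay_invStableKernel hν h one_pos).verticalIntegrable le_rfl le_rfl,
      fun x hx t ht => (fracSol_aux hγ hμ hν h hx ht).1⟩,
      fun t ht => contDiffOn_fracSol hγ hμ hν h ht 2,
      fun x hx t ht => hasRLDerivAt_fracSol hγ hμ hν h hx ht,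
      fun t ht => integrableOn_fracSol_and_integral_eq_one hγ hμ hν h ht,
      fun x hx => tendsto_fracSol_zero hγ hμ hν h hx, hpos, hneg⟩
  · refine ⟨fun h => absurd h (lt_irrefl _), ?_, ?_, ?_, ?_, hpos, hneg⟩
    · intro t ht
      simp_rw [fracSol_one]
      exact contDiffOn_genGammaTilde hγ μ ht
    · intro x hx t ht
      rw [HasRLDerivAt, if_pos rfl]
      simp_rw [fracSol_one]
      exact hasDerivAt_genGammaTilde hγ μ hx ht
    · intro t ht
      simp_rw [fracSol_one]
      exact ⟨integrableOn_genGammaTilde hγ hμ ht, integral_genGammaTilde hγ hμ ht⟩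
    · intro x hx
      simp_rw [fracSol_one]
      exact tendsto_genGammaTilde_zero hγ μ hx
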